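/- Let $\nu$ be a measure on a space $\Theta$ (written $d\theta$), let $\lambda_1,\dots,\lambda_L$ be grid points, let $\psi_{\lambda_\ell}\ge 0$ be measurable $\nu$-integrable functions on $\Theta$ and $p(\lambda_\ell)\ge 0$ numbers. Put $z(\lambda_\ell)=\int\psi_{\lambda_\ell}\,d\theta$, $\pi_{\lambda_\ell}=\psi_{\lambda_\ell}/z(\lambda_\ell)$, $$a_j(\theta)=\frac{\psi_{\lambda_j}(\theta)p(\lambda_j)}{\sum_{\ell=1}^L\psi_{\lambda_\ell}(\theta)p(\lambda_\ell)},\qquad F_{ij}=\int a_j(\theta)\,\pi_{\lambda_i}(\theta)\,d\theta ,$$ where $0/0=0$ and $1/0=0$, and assume that the matrix $F$ is irreducible (so that all $z(\lambda_\ell)$ and $p(\lambda_\ell)$ are positive and $F$ is stochastic). Let $u_\ell = L\,z(\lambda_\ell)p(\lambda_\ell)/\sum_k z(\lambda_k)p(\lambda_k)$, so that $u=F^{\mathsf T}u$ and $\sum_\ell u_\ell=L$. Let $\theta_i^{(n)}$ ($1\le i\le L$, $n\ge 1$) be independent random variables with $\theta_i^{(n)}\sim\pi_{\lambda_i}$ (hence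 the rows of $\widehat F$ below are independent). Consider a sequence of sample sizes $(N_1,\dots,N_L)$ with total $N=\sum_\ell N_\ell\to\infty$ and $N_\ell/N\to w_\ell>0$ for every $\ell$. Let $\widehat F_{ij}=N_i^{-1}\sum_{n=1}^{N_i}a_j(\theta_i^{(n)})$ and let $\widehat u$ be random vectors which, for all sufficiently late members of the sequence, almost surely solve $\widehat u=\widehat F^{\mathsf T}\widehat u$ with $\sum_\ell\widehat u_\ell=L$. Then there are $\sigma_\ell^2\ge 0$ such that, for every $\ell$, $\sqrt N(\widehat u_\ell-u_\ell)$ converges in distribution to a Gaussian variable with mean $0$ and variance $\sigma_\ell^2$ (a point mass at $0$ if $\sigma_\ell^2=0$), and $$\sup_\ell\frac{\sigma_\ell^2}{u_\ell^2}\le L\sum_{i=1}^L w_i^{-1}\sum_{j\ne i}\frac{R_{ij}}{Q_{ij}^2},$$ where $R_{ij}=\operatorname{Var}(a_j(\theta_i^{(1)}))$ and $Q_{ij}$ is the probability that the Markov chain on the grid with transition matrix $F$ started at $\lambda_i$ visits $\lambda_j$ before returning to $\lambda_i$. -/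

import Mathlib

open MeasureTheory ProbabilityTheory Filter Topology
open scoped NNReal ENNReal Matrix

noncomputable section

namespace EMUS

section Model

variable {Θ Λ : Type*} [MeasurableSpace Θ] {L : ℕ}

/-- The normalizing constant `z(l) = ∫ ψ_l(θ) dθ`, with `dθ` the reference measure `ν`. -/
def z (ν : Measure Θ) (ψ : Λ → Θ → ℝ) (l : Λ) : ℝ :=
  ∫ t, ψ l t ∂ν

/-- The local density `π_l(θ) = ψ_l(θ) / z(l)`. -/
def localDensity (ν : Measure Θ) (ψ : Λ → Θ → ℝ) (l : Λ) (t : Θ) : ℝ :=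
  ψ l t / z ν ψ l

/-- The local distribution, with density `π_l` with respect to `ν`. -/
def localLaw (ν : Measure Θ) (ψ : Λ → Θ → ℝ) (l : Λ) : Measure Θ :=
  ν.withDensity fun t => ENNReal.ofReal (localDensity ν ψ l t)

/-- The conditional probability of the grid point `λ_j` given `θ`:
`ψ_{λ_j}(θ) p(λ_j) / ∑_ℓ ψ_{λ_ℓ}(θ) p(λ_ℓ)`. -/
def weight (ψ : Λ → Θ → ℝ) (p : Λ → ℝ) (grid : Fin L → Λ) (j : Fin L) (t : Θ) : ℝ :=
  ψ (grid j) t * p (grid j) / ∑ l, ψ (grid l) t * p (grid l)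

/-- The transition matrix `F` of the Gibbs sampler on the grid. -/
def F (ν : Measure Θ) (ψ : Λ → Θ → ℝ) (p : Λ → ℝ) (grid : Fin L → Λ) :
    Matrix (Fin L) (Fin L) ℝ :=
  Matrix.of fun i j => ∫ t, weight ψ p grid j t * localDensity ν ψ (grid i) t ∂ν

/-- The target vector `u_ℓ ∝ z(λ_ℓ) p(λ_ℓ)`, normalized by `∑_ℓ u_ℓ = L`. -/
def u (ν : Measure Θ) (ψ : Λ → Θ → ℝ) (p : Λ → ℝ) (grid : Fin L → Λ) (l : Fin L) : ℝ :=
  L * (z ν ψ (grid l) * p (grid l)) / ∑ k, z ν ψ (grid k) * p (grid k)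

/-- `R_{ij}`, the variance of `ψ_{λ_j}(θ) p(λ_j) / ∑_ℓ ψ_{λ_ℓ}(θ) p(λ_ℓ)` under `θ ∼ π_{λ_i}`. -/
def R (ν : Measure Θ) (ψ : Λ → Θ → ℝ) (p : Λ → ℝ) (grid : Fin L → Λ) (i j : Fin L) : ℝ :=
  variance (weight ψ p grid j) (localLaw ν ψ (grid i))

/-- The Monte Carlo estimate of `F`, whose row `i` uses the samples `x i 0, …, x i (N i - 1)`. -/
def Fhat (ψ : Λ → Θ → ℝ) (p : Λ → ℝ) (grid : Fin L → Λ) (N : Fin L → ℕ)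
    (x : Fin L → ℕ → Θ) : Matrix (Fin L) (Fin L) ℝ :=
  Matrix.of fun i j => (1 / (N i : ℝ)) * ∑ n ∈ Finset.range (N i), weight ψ p grid j (x i n)

/-- `v` is an EMUS estimate for the matrix `M`: `v = Mᵀ v`, normalized by `∑_ℓ v_ℓ = L`.
(For a stochastic `M` such a `v` exists; it is unique if `M` is irreducible.) -/
def IsEMUSEstimate (M : Matrix (Fin L) (Fin L) ℝ) (v : Fin L → ℝ) : Prop :=
  v = Mᵀ *ᵥ v ∧ ∑ l, v l = L

end Model

section Chain

variable {L : ℕ}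

/-- One step of the Markov chain with transition matrix `M`. -/
def stepKernel (M : Matrix (Fin L) (Fin L) ℝ) : Kernel (Fin L) (Fin L) :=
  Kernel.ofFunOfCountable fun i => ∑ j, ENNReal.ofReal (M i j) • Measure.dirac j

theorem isMarkovKernel_stepKernel {M : Matrix (Fin L) (Fin L) ℝ}
    (hM : M ∈ Matrix.rowStochastic ℝ (Fin L)) : IsMarkovKernel (stepKernel M) := by
  refine ⟨fun i => ⟨?_⟩⟩
  change (∑ j, ENNReal.ofReal (M i j) • Measure.dirac j) Set.univ = 1
  have h : ∑ j, M i j = 1 := Matrix.sum_row_of_mem_rowStochastic hM i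
  simp [← ENNReal.ofReal_sum_of_nonneg (fun j _ => hM.1 i j), h]

/-- The transition from the trajectory up to time `n` to the state at time `n + 1`. It depends on
the state at time `n` only. -/
def historyKernel (M : Matrix (Fin L) (Fin L) ℝ) (n : ℕ) :
    Kernel (Finset.Iic n → Fin L) (Fin L) :=
  (stepKernel M).comap (fun x => x ⟨n, Finset.mem_Iic.2 le_rfl⟩) (measurable_pi_apply _)

theorem isMarkovKernel_historyKernel {M : Matrix (Fin L) (Fin L) ℝ}
    (hM : M ∈ Matrix.rowStochastic ℝ (Fin L)) (n : ℕ) : IsMarkovKernel (historyKernel M n) := by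
  have := isMarkovKernel_stepKernel hM
  unfold historyKernel
  infer_instance

/-- The law on trajectories of the Markov chain with transition matrix `M` started at `i`. -/
def chainLaw (M : Matrix (Fin L) (Fin L) ℝ) (hM : M ∈ Matrix.rowStochastic ℝ (Fin L))
    (i : Fin L) : Measure (ℕ → Fin L) :=
  haveI := isMarkovKernel_historyKernel hM
  Kernel.trajMeasure (X := fun _ => Fin L) (Measure.dirac i) (historyKernel M)

/-- `Q_{ij}`: the probability that the chain with transition matrix `M` started at `i` visits `j`
before returning to `i`. -/
def Q (M : Matrix (Fin L) (Fin L) ℝ) (hM : M ∈ Matrix.rowStochastic ℝ (Fin L))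
    (i j : Fin L) : ℝ :=
  (chainLaw M hM i).real {x | ∃ n, 0 < n ∧ x n = j ∧ ∀ k, 0 < k → k < n → x k ≠ i}

end Chain

section Stochastic

theorem weight_nonneg {Θ Λ : Type*} {L : ℕ}
    {ψ : Λ → Θ → ℝ} {p : Λ → ℝ} {grid : Fin L → Λ}
    (hψ : ∀ l t, 0 ≤ ψ (grid l) t) (hp : ∀ l, 0 ≤ p (grid l)) (j : Fin L) (t : Θ) :
    0 ≤ weight ψ p grid j t :=
  div_nonneg (mul_nonneg (hψ j t) (hp j))
    (Finset.sum_nonneg fun l _ => mul_nonneg (hψ l t) (hp l))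

theorem weight_le_one {Θ Λ : Type*} {L : ℕ}
    {ψ : Λ → Θ → ℝ} {p : Λ → ℝ} {grid : Fin L → Λ}
    (hψ : ∀ l t, 0 ≤ ψ (grid l) t) (hp : ∀ l, 0 ≤ p (grid l)) (j : Fin L) (t : Θ) :
    weight ψ p grid j t ≤ 1 :=
  div_le_one_of_le₀
    (Finset.single_le_sum (f := fun l => ψ (grid l) t * p (grid l))
      (fun l _ => mul_nonneg (hψ l t) (hp l)) (Finset.mem_univ j))
    (Finset.sum_nonneg fun l _ => mul_nonneg (hψ l t) (hp l))

/-- An irreducible `F` is a stochastic matrix. -/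
theorem F_mem_rowStochastic {Θ Λ : Type*} [MeasurableSpace Θ] {L : ℕ}
    {ν : Measure Θ} {ψ : Λ → Θ → ℝ} {p : Λ → ℝ} {grid : Fin L → Λ}
    (hψm : ∀ l, Measurable (ψ (grid l))) (hψ : ∀ l t, 0 ≤ ψ (grid l) t)
    (hψi : ∀ l, Integrable (ψ (grid l)) ν) (hp : ∀ l, 0 ≤ p (grid l))
    (hF : (F ν ψ p grid).IsIrreducible) :
    F ν ψ p grid ∈ Matrix.rowStochastic ℝ (Fin L) := by
  classical
  refine ⟨hF.nonneg, ?_⟩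
  ext i
  obtain ⟨k, hk, hpow⟩ := (Matrix.isIrreducible_iff_exists_pow_pos hF.nonneg).1 hF i i
  have hz : z ν ψ (grid i) ≠ 0 := by
    intro h0
    obtain ⟨k, rfl⟩ := Nat.exists_eq_succ_of_ne_zero hk.ne'
    rw [pow_succ', Matrix.mul_apply] at hpow
    simp [F, localDensity, h0] at hpow
  have hpi : p (grid i) ≠ 0 := by
    intro h0
    obtain ⟨k, rfl⟩ := Nat.exists_eq_succ_of_ne_zero hk.ne'
    rw [pow_succ, Matrix.mul_apply] at hpow
    simp [F, weight, h0] at hpow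
  have hdi : Integrable (localDensity ν ψ (grid i)) ν := (hψi i).div_const _
  have hint : ∀ j, Integrable (fun t => weight ψ p grid j t * localDensity ν ψ (grid i) t) ν := by
    intro j
    refine hdi.bdd_mul (c := 1) ?_ ?_
    · refine Measurable.aestronglyMeasurable ?_
      unfold weight
      fun_prop
    · refine Eventually.of_forall fun t => ?_
      rw [Real.norm_of_nonneg (weight_nonneg hψ hp j t)]
      exact weight_le_one hψ hp j t
  have hsum : ∀ t, ∑ j, weight ψ p grid j t * localDensity ν ψ (grid i) t
      = localDensity ν ψ (grid i) t := by
    intro t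
    rw [← Finset.sum_mul]
    by_cases ht : ψ (grid i) t = 0
    · simp [localDensity, ht]
    · have hpos : 0 < ∑ l, ψ (grid l) t * p (grid l) :=
        Finset.sum_pos' (fun l _ => mul_nonneg (hψ l t) (hp l))
          ⟨i, Finset.mem_univ i,
            mul_pos ((hψ i t).lt_of_ne' ht) ((hp i).lt_of_ne' hpi)⟩
      simp only [weight]
      rw [← Finset.sum_div, div_self hpos.ne', one_mul]
  simp only [Matrix.mulVec, dotProduct, F, Matrix.of_apply, Pi.one_apply, mul_one]
  rw [← integral_finsetSum _ fun j _ => hint j, integral_congr_ae (Eventually.of_forall hsum)]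
  simp only [localDensity]
  rw [integral_div]
  exact div_self hz

end Stochastic

end EMUS

end

/-! The estimator is a stationary vector of a perturbed stochastic matrix, so the result is a delta
method with an entrywise perturbation bound. Write E = F̂ − F. Subtracting the two fixed-point
equations gives d(1 − F) = uE + dE for d = û − u, a vector of total mass zero. With a generalized
inverse `B` of 1 − Fᵀ (`exists_fundamental_matrix`) this becomes d = B(uE) + B(dE), and for small E
the last term is quadratic in E (`exists_abs_sub_le_mul_sum_sq`). The mean square of E has order
1/N, so √N times the remainder vanishes in probability, and Slutsky's theorem leaves √N B(uE). This
is a sum over rows of independent centred sample means, with a Gaussian limit by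
`tendstoInDistribution_linear`. Row i contributes u_i² w_i⁻¹ Var(∑_j B_lj a_j) to the variance.

For the bound, ∑_j a_j = 1 almost surely, so only the differences μ_l = B_lj − B_li with j ≠ i
matter, and Cauchy–Schwarz over j costs the factor L. The vector μ solves μ(1 − F) = e_j − e_i and
has total mass zero. By the maximum principle for the reversed chain, μ/u is largest at j and
smallest at i. Pairing the equation with the probability of reaching j before i computes the
oscillation of μ/u exactly as 1/(u_i Q_ij). Mass zero puts 0 between the extremes, hence u_i |μ_l|
Q_ij ≤ u_l (`Q_pos_and_abs_mul_le`), which is uniform in l after division by u_l. -/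

noncomputable section

namespace EMUS

/-! ### Perturbation theory for the stationary vector of an irreducible matrix -/

section Irreducible

variable {ι : Type*} {M : Matrix ι ι ℝ} {v : ι → ℝ}

/-- Irreducibility gives a path from `a` to `b`, and `S` is carried backwards along it. This is the
propagation step of the maximum principle. -/
theorem forall_of_predecessor_closed (hM : M.IsIrreducible) {S : ι → Prop}
    (hS : ∀ a b, 0 < M a b → S b → S a) {b : ι} (hb : S b) (a : ι) : S a := by
  let : Quiver ι := M.toQuiver
  obtain ⟨q, -⟩ := hM.connected a b
  induction q with
  | nil => exact hb
  | cons q e ih => exact ih (hS _ _ e.down hb)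

variable [Fintype ι]

/-- Maximum principle for the time-reversed chain: `μ / v` is largest at `j` if `μ (1 - M)` is
nonpositive away from `j`. -/
theorem le_of_source_nonpos (hM : M.IsIrreducible) (hv : ∀ k, 0 < v k)
    (hvM : ∀ k, ∑ m, v m * M m k = v k) {r : ι → ℝ} {j : ι}
    (hr : ∀ k, k ≠ j → v k * r k ≤ ∑ m, v m * r m * M m k) (k : ι) : r k ≤ r j := by
  have : Nonempty ι := ⟨j⟩
  obtain ⟨k₀, hk₀⟩ := Finite.exists_max r
  by_contra! hlt
  have hj : r j < r k₀ := hlt.trans_le (hk₀ k)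
  -- At a maximizer `b ≠ j`, `r b` is at most an average of `r` over predecessors with weights `v m
  -- * M m b / v b`. So every predecessor with positive weight is a maximizer, and maximality would
  -- spread to `j`.
  refine hj.ne (forall_of_predecessor_closed hM (S := fun k => r k = r k₀) ?_ (b := k₀) rfl j)
  intro a b hab hb
  have hbj : b ≠ j := by
    rintro rfl
    exact hj.ne hb
  have hle : ∀ m ∈ Finset.univ, v m * r m * M m b ≤ r k₀ * (v m * M m b) := by
    intro m _
    have := mul_le_mul_of_nonneg_left (hk₀ m) (mul_nonneg (hv m).le (hM.nonneg m b))
    linarith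
  have hsum : ∑ m, v m * r m * M m b = ∑ m, r k₀ * (v m * M m b) := by
    refine le_antisymm (Finset.sum_le_sum hle) ?_
    rw [← Finset.mul_sum, hvM, ← hb, mul_comm]
    exact hr b hbj
  have h := (Finset.sum_eq_sum_iff_of_le hle).1 hsum a (Finset.mem_univ a)
  have hpos : 0 < v a * M a b := mul_pos (hv a) hab
  refine mul_left_cancel₀ hpos.ne' ?_
  linarith

/-- Entrywise perturbation bound: `μ` is the response of the stationary vector to moving mass from
`i` to `j`, and `h` is the probability of hitting `j` before `i`. -/
theorem hitting_pos_and_abs_mul_le [DecidableEq ι] (hM : M.IsIrreducible)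
    (hv : ∀ k, 0 < v k) (hvM : ∀ k, ∑ m, v m * M m k = v k)
    {i j : ι} (hij : i ≠ j) {μ : ι → ℝ} (hμ0 : ∑ k, μ k = 0)
    (hμ : ∀ k, μ k - ∑ m, μ m * M m k = (if k = j then 1 else 0) - (if k = i then 1 else 0))
    {h : ι → ℝ} (hi : h i = 0) (hj : h j = 1)
    (hh : ∀ k, k ≠ i → k ≠ j → h k = ∑ m, M k m * h m) (l : ι) :
    0 < ∑ m, M i m * h m ∧ v i * |μ l| * ∑ m, M i m * h m ≤ v l := by
  set q := ∑ m, M i m * h m with hq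
  set r : ι → ℝ := fun k => μ k / v k with hr
  have hvr : ∀ k, v k * r k = μ k := fun k => mul_div_cancel₀ _ (hv k).ne'
  have hmax : ∀ k, r k ≤ r j := by
    refine le_of_source_nonpos hM hv hvM fun k hk => ?_
    simp only [hvr]
    have := hμ k
    rw [if_neg hk] at this
    split_ifs at this <;> linarith
  have hmin : ∀ k, r i ≤ r k := by
    intro k
    have := le_of_source_nonpos hM hv hvM (r := fun k => - r k) (j := i) (fun k hk => ?_) k
    · simpa using this
    · simp only [mul_neg, hvr, neg_mul, Finset.sum_neg_distrib]
      have := hμ k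
      rw [if_neg hk] at this
      split_ifs at this <;> linarith
  -- pairing with a vector that is harmonic away from `i` and `j`
  have pair : ∀ y : ι → ℝ, ∑ k, (y k - ∑ m, y m * M m k) * h k
      = y j * (1 - ∑ m, M j m * h m) - y i * q := by
    intro y
    have h1 : ∑ k, (y k - ∑ m, y m * M m k) * h k = ∑ k, y k * (h k - ∑ m, M k m * h m) := by
      simp only [sub_mul, mul_sub, Finset.sum_sub_distrib, Finset.sum_mul, Finset.mul_sum]
      congr 1
      rw [Finset.sum_comm]
      simp only [mul_assoc]
    rw [h1, ← Finset.sum_subset (Finset.subset_univ {i, j}), Finset.sum_pair hij, hi, hj]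
    · ring
    · intro k _ hk
      simp only [Finset.mem_insert, Finset.mem_singleton, not_or] at hk
      rw [← hh k hk.1 hk.2, sub_self, mul_zero]
  have p1 := pair v
  have p2 := pair μ
  simp only [hvM, sub_self, zero_mul, Finset.sum_const_zero] at p1
  simp only [hμ, sub_mul, ite_mul, one_mul, zero_mul, Finset.sum_sub_distrib,
    Finset.sum_ite_eq', Finset.mem_univ, if_true, hi, hj, sub_zero] at p2
  rw [← hvr i, ← hvr j] at p2
  -- Pairing `v` with `h` balances the flow out of `i` against that out of `j`; this eliminates the
  -- unknown factor at `j` from the pairing of `μ`. Positivity of `q` follows from the same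
  -- identity.
  have key : v i * q * (r j - r i) = 1 := by linear_combination (r j) * p1 - p2
  have hq0 : 0 < q := by
    have h1 : 0 ≤ r j - r i := sub_nonneg.2 (hmax i)
    have h2 : 0 < (v i * q) * (r j - r i) := key ▸ one_pos
    have h3 := pos_of_mul_pos_left h2 h1
    exact pos_of_mul_pos_right h3 (hv i).le
  refine ⟨hq0, ?_⟩
  have hsum : ∑ k, v k * r k = 0 := by simpa only [hvr] using hμ0
  have hrj : 0 ≤ r j := by
    by_contra! hneg
    have : ∑ k, v k * r k < 0 := Finset.sum_neg
      (fun k _ => mul_neg_of_pos_of_neg (hv k) ((hmax k).trans_lt hneg)) ⟨i, Finset.mem_univ i⟩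
    exact this.ne hsum
  have hri : r i ≤ 0 := by
    by_contra! hpos
    have : 0 < ∑ k, v k * r k := Finset.sum_pos
      (fun k _ => mul_pos (hv k) (hpos.trans_le (hmin k))) ⟨i, Finset.mem_univ i⟩
    exact this.ne' hsum
  have habs : |r l| ≤ r j - r i := by
    rw [abs_le]
    constructor <;> linarith [hmax l, hmin l]
  rw [← hvr l, abs_mul, abs_of_pos (hv l)]
  calc v i * (v l * |r l|) * q = v l * (v i * q * |r l|) := by ring
    _ ≤ v l * (v i * q * (r j - r i)) := by
        gcongr
        · exact (hv l).le
        · exact mul_nonneg (hv i).le hq0.le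
    _ = v l := by rw [key, mul_one]

/-- A generalized inverse of `1 - Mᵀ`. -/
theorem exists_fundamental_matrix [DecidableEq ι] (hM : M.IsIrreducible)
    (hM1 : ∀ k, ∑ m, M k m = 1)
    (hv : ∀ k, 0 < v k) (hvM : ∀ k, ∑ m, v m * M m k = v k) :
    ∃ B : Matrix ι ι ℝ,
      (∀ d : ι → ℝ, ∑ k, d k = 0 → ∀ l, d l = ∑ j, B l j * (d j - ∑ m, d m * M m j)) ∧
      ∀ i j, ∑ l, (B l j - B l i) = 0 ∧
        ∀ k, (B k j - B k i) - ∑ m, (B m j - B m i) * M m k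
          = (if k = j then 1 else 0) - (if k = i then 1 else 0) := by
  rcases isEmpty_or_nonempty ι with he | ⟨⟨o⟩⟩
  · exact ⟨0, fun d _ l => he.elim l, fun i => he.elim i⟩
  have hvpos : 0 < ∑ k, v k := Finset.sum_pos (fun k _ => hv k) ⟨o, Finset.mem_univ o⟩
  -- The kernel of `1 - Mᵀ` is spanned by `v`. The rank-one term removes it and vanishes on vectors
  -- of sum zero, so `A⁻¹` serves as `B`.
  set A : Matrix ι ι ℝ := 1 - Mᵀ + Matrix.vecMulVec v 1 with hA
  have hAd : ∀ (d : ι → ℝ) k, (A *ᵥ d) k = d k - ∑ m, d m * M m k + v k * ∑ m, d m := by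
    intro d k
    simp only [hA, Matrix.add_mulVec, Matrix.sub_mulVec, Matrix.one_mulVec, Pi.add_apply,
      Pi.sub_apply]
    congr 1
    · congr 1
      simp only [Matrix.mulVec, dotProduct, Matrix.transpose_apply, mul_comm]
    · simp [Matrix.mulVec, dotProduct, Matrix.vecMulVec_apply, Finset.mul_sum]
  have hAsum : ∀ d : ι → ℝ, ∑ k, (A *ᵥ d) k = (∑ k, v k) * ∑ m, d m := by
    intro d
    simp only [hAd, Finset.sum_add_distrib, Finset.sum_sub_distrib, ← Finset.sum_mul]
    rw [Finset.sum_comm]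
    simp only [← Finset.mul_sum, hM1, mul_one, sub_self, zero_add]
  have hinj : Function.Injective A.mulVec := by
    intro d₁ d₂ h12
    have h0 : A *ᵥ (d₁ - d₂) = 0 := by
      rw [Matrix.mulVec_sub]
      exact sub_eq_zero.2 h12
    refine sub_eq_zero.1 ?_
    set d := d₁ - d₂
    have hs : ∑ m, d m = 0 := by
      have := hAsum d
      rw [h0] at this
      simp only [Pi.zero_apply, Finset.sum_const_zero] at this
      exact (mul_eq_zero.1 this.symm).resolve_left hvpos.ne'
    have hd : ∀ k, d k = ∑ m, d m * M m k := by
      intro k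
      have := hAd d k
      rw [h0, hs] at this
      simp only [Pi.zero_apply, mul_zero, add_zero] at this
      linarith
    have hvr : ∀ k, v k * (d k / v k) = d k := fun k => mul_div_cancel₀ _ (hv k).ne'
    -- An invariant `d` has no source anywhere, so the maximum principle applies with every `j` and
    -- makes `d / v` constant.
    have hle : ∀ j k, d k / v k ≤ d j / v j := by
      intro j
      refine le_of_source_nonpos hM hv hvM (r := fun k => d k / v k) fun k _ => ?_
      simp only [hvr]
      exact (hd k).le
    have hc : ∀ k, d k = (d o / v o) * v k := by
      intro k
      rw [← hvr k, le_antisymm (hle o k) (hle k o), mul_comm]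
    have : (d o / v o) * ∑ k, v k = 0 := by
      rw [Finset.mul_sum, ← hs]
      exact Finset.sum_congr rfl fun k _ => (hc k).symm
    have h00 := (mul_eq_zero.1 this).resolve_right hvpos.ne'
    ext k
    rw [hc k, h00, zero_mul, Pi.zero_apply]
  have hunit : IsUnit A := Matrix.mulVec_injective_iff_isUnit.1 hinj
  have hdet := (Matrix.isUnit_iff_isUnit_det A).1 hunit
  refine ⟨A⁻¹, fun d hd l => ?_, fun i j => ?_⟩
  · have h1 : A⁻¹ *ᵥ (A *ᵥ d) = d := by
      rw [Matrix.mulVec_mulVec, Matrix.nonsing_inv_mul _ hdet, Matrix.one_mulVec]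
    conv_lhs => rw [← h1]
    simp only [Matrix.mulVec, dotProduct]
    refine Finset.sum_congr rfl fun k _ => ?_
    congr 1
    have := hAd d k
    rw [hd, mul_zero, add_zero] at this
    exact this
  · set μ : ι → ℝ := fun l => A⁻¹ l j - A⁻¹ l i with hμ
    have hAμ : A *ᵥ μ = Pi.single j 1 - Pi.single i 1 := by
      have : μ = A⁻¹ *ᵥ (Pi.single j 1 - Pi.single i 1) := by
        ext l
        simp [hμ, Matrix.mulVec_sub]
      rw [this, Matrix.mulVec_mulVec, Matrix.mul_nonsing_inv _ hdet, Matrix.one_mulVec]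
    have hs : ∑ l, μ l = 0 := by
      have := hAsum μ
      rw [hAμ] at this
      simp only [Pi.sub_apply, Finset.sum_sub_distrib, Finset.sum_pi_single', Finset.mem_univ,
        if_true, sub_self] at this
      exact (mul_eq_zero.1 this.symm).resolve_left hvpos.ne'
    refine ⟨hs, fun k => ?_⟩
    have := hAd μ k
    rw [hs, hAμ, mul_zero, add_zero] at this
    rw [← this]
    simp [Pi.single_apply]

/-- First-order expansion of the stationary vector, with a quadratic remainder. -/
theorem exists_abs_sub_le_mul_sum_sq (M B : Matrix ι ι ℝ)
    (hB : ∀ d : ι → ℝ, ∑ k, d k = 0 → ∀ l, d l = ∑ j, B l j * (d j - ∑ m, d m * M m j))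
    (hvM : ∀ k, ∑ m, v m * M m k = v k) :
    ∃ δ > 0, ∃ C : ℝ, 0 < C ∧ ∀ (M' : Matrix ι ι ℝ) (v' : ι → ℝ),
      (∀ k, ∑ m, v' m * M' m k = v' k) → ∑ k, v' k = ∑ k, v k →
      ∑ i, ∑ j, (M' i j - M i j) ^ 2 ≤ δ →
      ∀ l, |(v' l - v l) - ∑ j, B l j * ∑ i, v i * (M' i j - M i j)|
        ≤ C * ∑ i, ∑ j, (M' i j - M i j) ^ 2 := by
  set n : ℝ := (Fintype.card ι : ℝ) with hn
  have hn0 : 0 ≤ n := Nat.cast_nonneg _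
  set b : ℝ := ∑ l, ∑ j, |B l j| with hb
  have hb0 : 0 ≤ b := Finset.sum_nonneg fun _ _ => Finset.sum_nonneg fun _ _ => abs_nonneg _
  have hBb : ∀ l, ∑ j, |B l j| ≤ b := fun l =>
    Finset.single_le_sum (f := fun l => ∑ j, |B l j|)
      (fun _ _ => Finset.sum_nonneg fun _ _ => abs_nonneg _) (Finset.mem_univ l)
  set U : ℝ := ∑ l, |v l| with hU
  have hU0 : 0 ≤ U := Finset.sum_nonneg fun _ _ => abs_nonneg _
  have hlin : ∀ (E : Matrix ι ι ℝ) (y : ι → ℝ) (l : ι),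
      |∑ j, B l j * ∑ i, y i * E i j| ≤ (∑ j, |B l j|) * ((∑ i, ∑ j, |E i j|) * ∑ i, |y i|) := by
    intro E y l
    refine (Finset.abs_sum_le_sum_abs _ _).trans ?_
    rw [Finset.sum_mul]
    refine Finset.sum_le_sum fun j _ => ?_
    rw [abs_mul]
    refine mul_le_mul_of_nonneg_left ?_ (abs_nonneg _)
    refine (Finset.abs_sum_le_sum_abs _ _).trans ?_
    rw [Finset.mul_sum]
    refine Finset.sum_le_sum fun i _ => ?_
    rw [abs_mul, mul_comm]
    refine mul_le_mul_of_nonneg_right ?_ (abs_nonneg _)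
    calc |E i j| ≤ ∑ j, |E i j| :=
          Finset.single_le_sum (f := fun j => |E i j|) (fun _ _ => abs_nonneg _) (Finset.mem_univ j)
      _ ≤ ∑ i, ∑ j, |E i j| := Finset.single_le_sum (f := fun i => ∑ j, |E i j|)
          (fun _ _ => Finset.sum_nonneg fun _ _ => abs_nonneg _) (Finset.mem_univ i)
  have hsq : ∀ E : Matrix ι ι ℝ, (∑ i, ∑ j, |E i j|) ^ 2 ≤ n ^ 2 * ∑ i, ∑ j, E i j ^ 2 := by
    intro E
    rw [← Finset.sum_product', ← Finset.sum_product']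
    refine (sq_sum_le_card_mul_sum_sq).trans (le_of_eq ?_)
    simp only [sq_abs, Finset.card_product, Finset.card_univ, Nat.cast_mul, hn]
    ring
  -- Since `s ≤ n √q` by Cauchy–Schwarz, this `δ` forces `b * s ≤ 1 / 2`, so the term in `D` can be
  -- absorbed. The added ones only secure strict positivity when `b`, `n` or `U` is zero.
  refine ⟨(2 * (b + 1) * (n + 1))⁻¹ ^ 2, by positivity, 2 * b * b * U * n ^ 2 + 1, by positivity,
    fun M' v' hv' hs hE l => ?_⟩
  set E : Matrix ι ι ℝ := M' - M with hEdef
  have hEij : ∀ i j, M' i j - M i j = E i j := fun i j => rfl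
  simp only [hEij] at hE ⊢
  set s := ∑ i, ∑ j, |E i j| with hs_def
  set q := ∑ i, ∑ j, E i j ^ 2 with hq_def
  have hs0 : 0 ≤ s := Finset.sum_nonneg fun _ _ => Finset.sum_nonneg fun _ _ => abs_nonneg _
  have hq0 : 0 ≤ q := Finset.sum_nonneg fun _ _ => Finset.sum_nonneg fun _ _ => sq_nonneg _
  have hsmall : b * s ≤ 1 / 2 := by
    have h1 : s ^ 2 ≤ ((n + 1) * (2 * (b + 1) * (n + 1))⁻¹) ^ 2 := by
      rw [mul_pow]
      refine (hsq E).trans (mul_le_mul ?_ hE hq0 (by positivity))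
      exact pow_le_pow_left₀ hn0 (by linarith) 2
    have h2 : s ≤ (n + 1) * (2 * (b + 1) * (n + 1))⁻¹ :=
      le_of_sq_le_sq h1 (by positivity)
    have h3 : (n + 1) * (2 * (b + 1) * (n + 1))⁻¹ = (2 * (b + 1))⁻¹ := by
      field_simp
    rw [h3] at h2
    calc b * s ≤ (b + 1) * (2 * (b + 1))⁻¹ := by gcongr; linarith
      _ = 1 / 2 := by field_simp
  set d : ι → ℝ := fun k => v' k - v k with hd
  have hd0 : ∑ k, d k = 0 := by simp [hd, hs]
  have hdeq : ∀ l, d l = ∑ j, B l j * ∑ i, v i * E i j + ∑ j, B l j * ∑ i, d i * E i j := by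
    intro l
    rw [hB d hd0 l, ← Finset.sum_add_distrib]
    refine Finset.sum_congr rfl fun j _ => ?_
    rw [← mul_add, ← Finset.sum_add_distrib]
    congr 1
    have h1 : d j = ∑ m, v' m * M' m j - ∑ m, v m * M m j := by rw [hv', hvM]
    rw [h1, ← Finset.sum_sub_distrib, ← Finset.sum_sub_distrib]
    refine Finset.sum_congr rfl fun i _ => ?_
    simp only [hd, hEdef, Matrix.sub_apply]
    ring
  set D := ∑ k, |d k| with hD
  have hD0 : 0 ≤ D := Finset.sum_nonneg fun _ _ => abs_nonneg _
  have hDle : D ≤ b * (s * U) + b * (s * D) := by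
    have : ∀ l, |d l| ≤ (∑ j, |B l j|) * (s * U) + (∑ j, |B l j|) * (s * D) := by
      intro l
      conv_lhs => rw [hdeq l]
      exact (abs_add_le _ _).trans (add_le_add (hlin E v l) (hlin E d l))
    calc D ≤ ∑ l, ((∑ j, |B l j|) * (s * U) + (∑ j, |B l j|) * (s * D)) :=
          Finset.sum_le_sum fun l _ => this l
      _ = _ := by rw [Finset.sum_add_distrib, ← Finset.sum_mul, ← Finset.sum_mul]
  have hD2 : D ≤ 2 * b * s * U := by
    have : b * s * D ≤ 1 / 2 * D := mul_le_mul_of_nonneg_right hsmall hD0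
    linarith
  have h1 : (v' l - v l) - ∑ j, B l j * ∑ i, v i * E i j = ∑ j, B l j * ∑ i, d i * E i j := by
    have := hdeq l
    simp only [hd] at this ⊢
    linarith
  rw [h1]
  calc |∑ j, B l j * ∑ i, d i * E i j| ≤ (∑ j, |B l j|) * (s * D) := hlin E d l
    _ ≤ b * (s * (2 * b * s * U)) := by
        gcongr
        exact hBb l
    _ = 2 * b * b * U * s ^ 2 := by ring
    _ ≤ 2 * b * b * U * (n ^ 2 * q) := by
        gcongr
        exact hsq E
    _ ≤ (2 * b * b * U * n ^ 2 + 1) * q := by linarith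

end Irreducible

/-! ### Escape probabilities of the chain by taboo matrices -/

section Hitting

variable {L : ℕ} {M : Matrix (Fin L) (Fin L) ℝ}

instance isProbabilityMeasure_chainLaw (hM : M ∈ Matrix.rowStochastic ℝ (Fin L)) (a : Fin L) :
    IsProbabilityMeasure (chainLaw M hM a) := by
  have := isMarkovKernel_historyKernel hM
  unfold chainLaw
  infer_instance

theorem stepKernel_singleton (M : Matrix (Fin L) (Fin L) ℝ) (m k : Fin L) :
    stepKernel M m {k} = ENNReal.ofReal (M m k) := by
  change (∑ j, ENNReal.ofReal (M m j) • Measure.dirac j) {k} = _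
  rw [Measure.finsetSum_apply, Finset.sum_eq_single k]
  · simp
  · intro j _ hj
    simp [hj]
  · simp

theorem chainLaw_map_zero (hM : M ∈ Matrix.rowStochastic ℝ (Fin L)) (a : Fin L) :
    ∀ᵐ x ∂chainLaw M hM a, x 0 = a := by
  have := isMarkovKernel_historyKernel hM
  have hmap : (chainLaw M hM a).map (Preorder.frestrictLe (π := fun _ => Fin L) 0)
      = (Measure.dirac a).map (MeasurableEquiv.piUnique
          (fun _ : Finset.Iic 0 => Fin L)).symm := by
    unfold chainLaw Kernel.trajMeasure
    rw [Measure.map_comp _ _ (by fun_prop), Kernel.traj_map_frestrictLe,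
      Kernel.partialTraj_self, Measure.id_comp]
  have h : ∀ᵐ y ∂(chainLaw M hM a).map (Preorder.frestrictLe (π := fun _ => Fin L) 0),
      y ⟨0, Finset.mem_Iic.2 le_rfl⟩ = a := by
    rw [hmap, ae_map_iff (by fun_prop) (measurableSet_eq_fun (by fun_prop) (by fun_prop)),
      ae_dirac_iff (Set.toFinite _).measurableSet]
    rfl
  exact ae_of_ae_map (by fun_prop) h

/-- One-step Markov property. -/
theorem chainLaw_step (hM : M ∈ Matrix.rowStochastic ℝ (Fin L)) (a : Fin L) (n : ℕ)
    (A : Set (Finset.Iic n → Fin L)) (m k : Fin L) :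
    (chainLaw M hM a).real {x | Preorder.frestrictLe n x ∈ A ∧ x n = m ∧ x (n + 1) = k}
      = (chainLaw M hM a).real {x | Preorder.frestrictLe n x ∈ A ∧ x n = m} * M m k := by
  have := isMarkovKernel_historyKernel hM
  have hmeas : ∀ S : Set (Finset.Iic n → Fin L), MeasurableSet S :=
    fun S => (Set.toFinite S).measurableSet
  set S : Set (Finset.Iic n → Fin L) := A ∩ {y | y ⟨n, Finset.mem_Iic.2 le_rfl⟩ = m} with hS
  have h := congrArg (fun ρ => ρ (S ×ˢ {k}))
    (Kernel.map_frestrictLe_trajMeasure_compProd_eq_map_trajMeasure (X := fun _ => Fin L)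
      (μ₀ := Measure.dirac a) (κ := historyKernel M) (a := n))
  beta_reduce at h
  rw [Measure.compProd_apply_prod (hmeas S) (measurableSet_singleton k),
    Measure.map_apply (by fun_prop) ((hmeas S).prod (measurableSet_singleton k))] at h
  -- On `S` the current state is `m`, so the transition probability to `k` is constant whatever the
  -- earlier past.
  have hconst : ∫⁻ y in S, historyKernel M n y {k}
        ∂(chainLaw M hM a).map (Preorder.frestrictLe (π := fun _ => Fin L) n)
      = ENNReal.ofReal (M m k) *
        (chainLaw M hM a).map (Preorder.frestrictLe (π := fun _ => Fin L) n) S := by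
    rw [← setLIntegral_const]
    refine setLIntegral_congr_fun (hmeas S) fun y hy => ?_
    change stepKernel M (y ⟨n, _⟩) {k} = _
    rw [hy.2, stepKernel_singleton]
  have h' := hconst.symm.trans h
  rw [Measure.map_apply (by fun_prop) (hmeas S)] at h'
  have h'' := congrArg ENNReal.toReal h'
  rw [ENNReal.toReal_mul, ENNReal.toReal_ofReal (hM.1 m k), mul_comm] at h''
  rw [Measure.real, Measure.real]
  refine Eq.trans ?_ (h''.symm.trans ?_)
  · congr 2
    ext x
    simp [hS, Preorder.frestrictLe, and_assoc]
  · congr 2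

/-- The one-step transition matrix restricted to arrivals outside `{i, j}`. -/
def tabooMatrix (M : Matrix (Fin L) (Fin L) ℝ) (i j : Fin L) : Matrix (Fin L) (Fin L) ℝ :=
  Matrix.of fun a m => if m = i ∨ m = j then 0 else M a m

/-- Induction on `n`, splitting by the state just before the last step: taboo steps multiply by
`tabooMatrix`, while the last step is free. Time zero is unconstrained, so the start may be `i`
itself, as `Q` requires. -/
theorem chainLaw_taboo (hM : M ∈ Matrix.rowStochastic ℝ (Fin L)) (i j a : Fin L) (n : ℕ)
    (k : Fin L) :
    (chainLaw M hM a).real {x | x (n + 1) = k ∧ ∀ t, 0 < t → t ≤ n → x t ≠ i ∧ x t ≠ j}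
      = (tabooMatrix M i j ^ n * M) a k := by
  induction n generalizing k with
  | zero =>
    have h := chainLaw_step hM a 0 Set.univ a k
    have h0 := chainLaw_map_zero hM a
    have h1 : (chainLaw M hM a).real {x | Preorder.frestrictLe 0 x ∈ Set.univ ∧ x 0 = a} = 1 := by
      rw [Measure.real, (prob_compl_eq_zero_iff₀ ?_).1, ENNReal.toReal_one]
      · simpa [ae_iff, Set.compl_ofPred] using h0
      · simp only [Set.mem_univ, true_and]
        exact (measurableSet_eq_fun (by fun_prop) (by fun_prop)).nullMeasurableSet
    rw [h1, one_mul] at h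
    rw [pow_zero, one_mul, ← h]
    refine measureReal_congr ?_
    filter_upwards [h0] with x hx
    refine propext ?_
    change (x (0 + 1) = k ∧ _) ↔ (_ ∧ x 0 = a ∧ x (0 + 1) = k)
    simp only [hx, Set.mem_univ, true_and]
    exact ⟨fun h => h.1, fun h => ⟨h, fun t ht ht' => absurd ht' (by omega)⟩⟩
  | succ n ih =>
    set A : Set (Finset.Iic (n + 1) → Fin L) :=
      {y | ∀ t, ∀ ht : t ≤ n + 1, 0 < t →
        y ⟨t, Finset.mem_Iic.2 ht⟩ ≠ i ∧ y ⟨t, Finset.mem_Iic.2 ht⟩ ≠ j} with hA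
    have hAx : ∀ x : ℕ → Fin L, Preorder.frestrictLe (n + 1) x ∈ A ↔
        ∀ t, 0 < t → t ≤ n + 1 → x t ≠ i ∧ x t ≠ j :=
      fun x => ⟨fun h t h0 h1 => h t h1 h0, fun h t h1 h0 => h t h0 h1⟩
    have hsplit : {x : ℕ → Fin L | x (n + 1 + 1) = k ∧
          ∀ t, 0 < t → t ≤ n + 1 → x t ≠ i ∧ x t ≠ j}
        = ⋃ m ∈ (Finset.univ : Finset (Fin L)), {x : ℕ → Fin L | Preorder.frestrictLe (n + 1) x ∈ A ∧
            x (n + 1) = m ∧ x (n + 1 + 1) = k} := by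
      ext x
      simp only [Set.mem_ofPred_eq, Set.mem_iUnion, Finset.mem_univ, exists_prop, true_and, hAx]
      exact ⟨fun h => ⟨x (n + 1), h.2, rfl, h.1⟩, fun ⟨m, h, _, h'⟩ => ⟨h', h⟩⟩
    have hAmeas : MeasurableSet A := (Set.toFinite A).measurableSet
    have hmeas : ∀ m, MeasurableSet {x : ℕ → Fin L | Preorder.frestrictLe (n + 1) x ∈ A ∧
            x (n + 1) = m ∧ x (n + 1 + 1) = k} := by
      intro m
      have h1 : Measurable (Preorder.frestrictLe (π := fun _ : ℕ => Fin L) (n + 1)) := by fun_prop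
      exact (h1 hAmeas).inter ((measurableSet_eq_fun (by fun_prop) (by fun_prop)).inter
        (measurableSet_eq_fun (by fun_prop) (by fun_prop)))
    rw [hsplit, measureReal_biUnion_finset ?_ fun m _ => hmeas m]
    · rw [pow_succ, mul_assoc, Matrix.mul_apply]
      have hterm : ∀ m, (chainLaw M hM a).real {x | Preorder.frestrictLe (n + 1) x ∈ A ∧
            x (n + 1) = m ∧ x (n + 1 + 1) = k}
          = (if m = i ∨ m = j then 0 else (tabooMatrix M i j ^ n * M) a m) * M m k := by
        intro m
        rw [chainLaw_step]
        congr 1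
        split_ifs with hm
        · have : {x : ℕ → Fin L | Preorder.frestrictLe (n + 1) x ∈ A ∧ x (n + 1) = m} = ∅ := by
            refine Set.eq_empty_of_forall_notMem fun x hx => ?_
            have := (hAx x).1 hx.1 (n + 1) n.succ_pos le_rfl
            rw [hx.2] at this
            tauto
          rw [this, measureReal_empty]
        · rw [← ih m]
          congr 1
          ext x
          simp only [Set.mem_ofPred_eq, hAx]
          constructor
          · exact fun h => ⟨h.2, fun t h0 h1 => h.1 t h0 (h1.trans n.le_succ)⟩
          · refine fun h => ⟨fun t h0 h1 => ?_, h.1⟩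
            rcases Nat.le_succ_iff.1 h1 with h1 | h1
            · exact h.2 t h0 h1
            · rw [Nat.succ_eq_add_one] at h1
              rw [h1, h.1]
              tauto
      simp only [hterm]
      have hT : ∀ m : Fin L, (if m = i ∨ m = j then 0 else (tabooMatrix M i j ^ n * M) a m)
          = (tabooMatrix M i j ^ n * tabooMatrix M i j) a m := by
        intro m
        simp only [Matrix.mul_apply, tabooMatrix, Matrix.of_apply]
        split_ifs <;> simp
      simp only [hT]
      rw [← Matrix.mul_apply, mul_assoc, Matrix.mul_apply]
    · intro m _ m' _ hmm
      refine Set.disjoint_left.2 fun x hx hx' => hmm ?_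
      exact hx.2.1.symm.trans hx'.2.1

/-- The probability that the chain started at `a` reaches `j` (at a positive time) before `i`. -/
def hitProb (M : Matrix (Fin L) (Fin L) ℝ) (hM : M ∈ Matrix.rowStochastic ℝ (Fin L))
    (i j a : Fin L) : ℝ :=
  (chainLaw M hM a).real {x | ∃ n, 0 < n ∧ x n = j ∧ ∀ k, 0 < k → k < n → x k ≠ i}

/-- The event is split according to the first positive time at which `j` is visited; before it both
`i` and `j` are avoided. -/
theorem hasSum_hitProb (hM : M ∈ Matrix.rowStochastic ℝ (Fin L)) (i j a : Fin L) :
    HasSum (fun n => (tabooMatrix M i j ^ n * M) a j) (hitProb M hM i j a) := by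
  set S : ℕ → Set (ℕ → Fin L) := fun n =>
    {x | x (n + 1) = j ∧ ∀ t, 0 < t → t ≤ n → x t ≠ i ∧ x t ≠ j} with hS
  have hunion : {x : ℕ → Fin L | ∃ n, 0 < n ∧ x n = j ∧ ∀ k, 0 < k → k < n → x k ≠ i}
      = ⋃ n, S n := by
    classical
    ext x
    simp only [Set.mem_ofPred_eq, Set.mem_iUnion, hS]
    constructor
    · intro h
      have hmin := @Nat.find_min _ _ h
      obtain ⟨h0, h1, h2⟩ := Nat.find_spec h
      set n := Nat.find h
      obtain ⟨n', hn'⟩ := Nat.exists_eq_succ_of_ne_zero h0.ne'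
      refine ⟨n', ?_, fun t ht htn => ?_⟩
      · rw [← Nat.succ_eq_add_one, ← hn', h1]
      · have htn' : t < n := by omega
        refine ⟨h2 t ht htn', fun htj => hmin htn' ⟨ht, htj, fun k hk hkt => ?_⟩⟩
        exact h2 k hk (hkt.trans htn')
    · rintro ⟨n, h1, h2⟩
      exact ⟨n + 1, n.succ_pos, h1, fun k hk hkn => (h2 k hk (Nat.lt_succ_iff.1 hkn)).1⟩
  have hmeas : ∀ n, MeasurableSet (S n) := by
    intro n
    have hc : ∀ (t : ℕ) (b : Fin L), MeasurableSet {x : ℕ → Fin L | x t = b} :=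
      fun t b => measurableSet_eq_fun (by fun_prop) (by fun_prop)
    have hne : ∀ (t : ℕ), MeasurableSet {x : ℕ → Fin L | 0 < t → t ≤ n → x t ≠ i ∧ x t ≠ j} := by
      intro t
      by_cases h : 0 < t ∧ t ≤ n
      · simp only [h.1, h.2, forall_const]
        exact (hc t i).compl.inter (hc t j).compl
      · convert! MeasurableSet.univ
        refine Set.eq_univ_of_forall fun x h0 h1 => absurd ⟨h0, h1⟩ h
    have : S n = {x | x (n + 1) = j} ∩
        ⋂ t, {x : ℕ → Fin L | 0 < t → t ≤ n → x t ≠ i ∧ x t ≠ j} := by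
      ext x
      simp [hS]
    rw [this]
    exact (hc _ _).inter (MeasurableSet.iInter hne)
  have hdisj : Pairwise (Function.onFun Disjoint S) := by
    have hlt : ∀ n n', n < n' → Disjoint (S n) (S n') := fun n n' h =>
      Set.disjoint_left.2 fun x hx hx' => (hx'.2 (n + 1) n.succ_pos h).2 hx.1
    intro n n' hne
    rcases lt_or_gt_of_ne hne with h | h
    · exact hlt _ _ h
    · exact (hlt _ _ h).symm
  rw [hitProb, hunion]
  have h := measure_iUnion (μ := chainLaw M hM a) hdisj hmeas
  have hne : ∑' n, chainLaw M hM a (S n) ≠ ⊤ := h ▸ measure_ne_top _ _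
  have hsum := ENNReal.hasSum_toReal hne
  rw [Measure.real, h, ENNReal.tsum_toReal_eq fun n => measure_ne_top _ _]
  convert! hsum using 2 with n
  · exact (chainLaw_taboo hM i j a n j).symm

/-- First-step analysis, read off from the series by factoring one `tabooMatrix` out of every term
but the first. No Markov property for infinite futures is needed. -/
theorem hitProb_eq_sum (hM : M ∈ Matrix.rowStochastic ℝ (Fin L)) {i j : Fin L} (hij : i ≠ j)
    (a : Fin L) :
    hitProb M hM i j a
      = ∑ m, M a m * (if m = i then 0 else if m = j then 1 else hitProb M hM i j m) := by
  have h1 := (hasSum_nat_add_iff' 1).2 (hasSum_hitProb hM i j a)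
  have h2 : HasSum (fun n => (tabooMatrix M i j ^ (n + 1) * M) a j)
      (∑ m, tabooMatrix M i j a m * hitProb M hM i j m) := by
    simp only [pow_succ', mul_assoc, Matrix.mul_apply (M := tabooMatrix M i j)]
    exact hasSum_sum fun m _ => (hasSum_hitProb hM i j m).mul_left _
  have h3 := h1.unique h2
  simp only [Finset.range_one, Finset.sum_singleton, pow_zero, one_mul] at h3
  have h4 : M a j = ∑ m, if m = j then M a m else 0 := by simp
  rw [sub_eq_iff_eq_add, h4, ← Finset.sum_add_distrib] at h3
  rw [h3]
  refine Finset.sum_congr rfl fun m _ => ?_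
  simp only [tabooMatrix, Matrix.of_apply]
  by_cases hmi : m = i
  · simp [hmi, hij]
  · by_cases hmj : m = j
    · simp [hmj, hij.symm]
    · simp [hmi, hmj]

/-- The perturbation bound in terms of the escape probabilities `Q`. -/
theorem Q_pos_and_abs_mul_le (hM : M ∈ Matrix.rowStochastic ℝ (Fin L)) (hirr : M.IsIrreducible)
    {v : Fin L → ℝ} (hv : ∀ k, 0 < v k) (hvM : ∀ k, ∑ m, v m * M m k = v k)
    {i j : Fin L} (hij : i ≠ j) {μ : Fin L → ℝ} (hμ0 : ∑ k, μ k = 0)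
    (hμ : ∀ k, μ k - ∑ m, μ m * M m k = (if k = j then 1 else 0) - (if k = i then 1 else 0))
    (l : Fin L) :
    0 < Q M hM i j ∧ v i * |μ l| * Q M hM i j ≤ v l := by
  have hQ : Q M hM i j = hitProb M hM i j i := rfl
  rw [hQ, hitProb_eq_sum hM hij]
  -- `hitProb` counts positive times only, so the harmonic function must be reset to its boundary
  -- values 0 at `i` and 1 at `j`.
  refine hitting_pos_and_abs_mul_le hirr hv hvM hij hμ0 hμ
    (h := fun m => if m = i then 0 else if m = j then 1 else hitProb M hM i j m)
    (by simp) (by simp [hij.symm]) (fun k hki hkj => ?_) l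
  simp only [hki, hkj, if_false]
  exact hitProb_eq_sum hM hij k

end Hitting

/-! ### Central limit theorem for several samples of different sizes -/

section CentralLimit

variable {Ω : Type*} [MeasurableSpace Ω] {P : Measure Ω}
  {ι : Type*} [Fintype ι]

/-- Independence over all pairs factors the characteristic function completely; the factors are then
regrouped by row. -/
theorem charFun_map_sum_sum_range {W : ι × ℕ → Ω → ℝ} (hW : ∀ k, AEMeasurable (W k) P)
    (hind : iIndepFun W P) (N : ι → ℕ) :
    charFun (P.map fun ω => ∑ i, ∑ n ∈ Finset.range (N i), W (i, n) ω)
      = ∏ i, charFun (P.map fun ω => ∑ n ∈ Finset.range (N i), W (i, n) ω) := by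
  classical
  set s : Finset (ι × ℕ) := (Finset.univ.sigma fun i => Finset.range (N i)).map
    (Equiv.sigmaEquivProd ι ℕ).toEmbedding with hs
  have hmem : ∀ k, k ∈ s ↔ k.1 ∈ (Finset.univ : Finset ι) ∧ k.2 ∈ Finset.range (N k.1) := by
    rintro ⟨i, n⟩
    simp [hs]
  have h1 : (fun ω => ∑ i, ∑ n ∈ Finset.range (N i), W (i, n) ω) = fun ω => ∑ k ∈ s, W k ω := by
    ext ω
    exact (Finset.sum_finset_product s Finset.univ (fun i => Finset.range (N i)) hmem
      (f := fun k => W k ω)).symm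
  rw [h1, (hind.restrict s).charFun_map_fun_finsetSum_eq_prod fun k _ => hW k,
    Finset.prod_finset_product s Finset.univ (fun i => Finset.range (N i)) hmem]
  refine Finset.prod_congr rfl fun i _ => ?_
  have hi : iIndepFun (fun n => W (i, n)) P :=
    hind.precomp (g := fun n => (i, n)) fun a b hab => (Prod.mk.inj hab).2
  exact ((hi.restrict _).charFun_map_fun_finsetSum_eq_prod fun n _ => hW (i, n)).symm

variable [IsProbabilityMeasure P]

/-- The classical theorem composed with `N`, then Slutsky's theorem for the deterministic factor `c
m`. -/
theorem tendstoInDistribution_mul_inv_sqrt_mul_sum {Y : ℕ → Ω → ℝ} (hY : MemLp (Y 0) 2 P)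
    (hind : iIndepFun Y P) (hident : ∀ n, IdentDistrib (Y n) (Y 0) P P)
    {N : ℕ → ℕ} (hN : Tendsto N atTop atTop) {c : ℕ → ℝ} {c₀ : ℝ}
    (hc : Tendsto c atTop (𝓝 c₀)) :
    TendstoInDistribution
      (fun m ω => c m * ((√(N m))⁻¹ * (∑ n ∈ Finset.range (N m), Y n ω - N m * P[Y 0])))
      atTop (fun x : ℝ => c₀ * x) (fun _ => P) (gaussianReal 0 Var[Y 0; P].toNNReal) := by
  have h := tendstoInDistribution_inv_sqrt_mul_sum_sub (Y := (id : ℝ → ℝ))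
    (P' := gaussianReal 0 Var[Y 0; P].toNNReal) HasLaw.id hY hind hident
  have h' : TendstoInDistribution
      (fun m ω => (√(N m))⁻¹ * (∑ n ∈ Finset.range (N m), Y n ω - N m * P[Y 0]))
      atTop (id : ℝ → ℝ) (fun _ => P) (gaussianReal 0 Var[Y 0; P].toNNReal) :=
    ⟨fun m => h.forall_aemeasurable (N m), h.aemeasurable_limit, h.tendsto.comp hN⟩
  have hc' : TendstoInMeasure P (fun m (_ : Ω) => c m) atTop fun _ => c₀ :=
    tendstoInMeasure_of_tendsto_ae (fun _ => aestronglyMeasurable_const)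
      (Eventually.of_forall fun _ => hc)
  exact h'.continuous_comp_prodMk_of_tendstoInMeasure_const (g := fun q : ℝ × ℝ => q.2 * q.1)
    (by fun_prop) hc' fun _ => aemeasurable_const

/-- Central limit theorem for a weighted sum of finitely many independent i.i.d. samples of
different sizes. -/
theorem tendstoInDistribution_sum_mul_inv_sqrt_mul_sum {Y : ι → ℕ → Ω → ℝ}
    (hY : ∀ i, MemLp (Y i 0) 2 P)
    (hind : iIndepFun (fun k : ι × ℕ => Y k.1 k.2) P)
    (hident : ∀ i n, IdentDistrib (Y i n) (Y i 0) P P)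
    {N : ℕ → ι → ℕ} (hN : ∀ i, Tendsto (fun m => N m i) atTop atTop)
    {c : ℕ → ι → ℝ} {c₀ : ι → ℝ} (hc : ∀ i, Tendsto (fun m => c m i) atTop (𝓝 (c₀ i))) :
    TendstoInDistribution
      (fun m ω => ∑ i, c m i *
        ((√(N m i))⁻¹ * (∑ n ∈ Finset.range (N m i), Y i n ω - N m i * P[Y i 0])))
      atTop (id : ℝ → ℝ) (fun _ => P)
      (gaussianReal 0 (∑ i, c₀ i ^ 2 * Var[Y i 0; P]).toNNReal) := by
  have hYm : ∀ i n, AEMeasurable (Y i n) P := fun i n => (hident i n).aemeasurable_fst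
  have hZ : ∀ i, TendstoInDistribution
      (fun m ω => c m i *
        ((√(N m i))⁻¹ * (∑ n ∈ Finset.range (N m i), Y i n ω - N m i * P[Y i 0])))
      atTop (fun x : ℝ => c₀ i * x) (fun _ => P) (gaussianReal 0 Var[Y i 0; P].toNNReal) :=
    fun i => tendstoInDistribution_mul_inv_sqrt_mul_sum (hY i)
      (hind.precomp (g := fun n => (i, n)) fun a b hab => (Prod.mk.inj hab).2) (hident i)
      (hN i) (hc i)
  refine ⟨fun m => Finset.aemeasurable_fun_sum _ fun i _ => (hZ i).forall_aemeasurable m,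
    aemeasurable_id, ?_⟩
  -- By Lévy's continuity theorem it suffices to multiply the limits of the rows' characteristic
  -- functions; the Gaussian exponents add.
  refine ProbabilityMeasure.tendsto_iff_tendsto_charFun.2 fun t => ?_
  have hZt := fun i => ProbabilityMeasure.tendsto_iff_tendsto_charFun.1 (hZ i).tendsto t
  simp only [ProbabilityMeasure.coe_mk] at hZt ⊢
  have hprod : ∀ m, charFun (P.map fun ω => ∑ i, c m i *
        ((√(N m i))⁻¹ * (∑ n ∈ Finset.range (N m i), Y i n ω - N m i * P[Y i 0]))) t
      = ∏ i, charFun (P.map fun ω => c m i *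
        ((√(N m i))⁻¹ * (∑ n ∈ Finset.range (N m i), Y i n ω - N m i * P[Y i 0]))) t := by
    intro m
    have hrew : ∀ i ω, c m i *
        ((√(N m i))⁻¹ * (∑ n ∈ Finset.range (N m i), Y i n ω - N m i * P[Y i 0]))
        = ∑ n ∈ Finset.range (N m i), c m i * ((√(N m i))⁻¹ * (Y i n ω - P[Y i 0])) := by
      intro i ω
      rw [← Finset.mul_sum, ← Finset.mul_sum, Finset.sum_sub_distrib]
      simp
    simp only [hrew]
    have hW := charFun_map_sum_sum_range
      (W := fun k : ι × ℕ => fun ω => c m k.1 * ((√(N m k.1))⁻¹ * (Y k.1 k.2 ω - P[Y k.1 0])))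
      (P := P) (fun k => ((hYm k.1 k.2).sub_const _).const_mul _ |>.const_mul _)
      (hind.comp (fun k x => c m k.1 * ((√(N m k.1))⁻¹ * (x - ∫ ω, Y k.1 0 ω ∂P)))
        fun k => by fun_prop) (N m)
    rw [hW, Finset.prod_apply]
  simp only [hprod]
  have hlim := tendsto_finsetProd Finset.univ fun i _ => hZt i
  refine hlim.trans_eq ?_
  congr 1
  have hid : ∀ v : ℝ≥0, (gaussianReal 0 v).map (id : ℝ → ℝ) = gaussianReal 0 v :=
    fun v => Measure.map_id
  have hscale : ∀ i, charFun ((gaussianReal 0 Var[Y i 0; P].toNNReal).map fun x => c₀ i * x) t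
      = Complex.exp (-(((c₀ i ^ 2 * Var[Y i 0; P] : ℝ) : ℂ) * t ^ 2 / 2)) := by
    intro i
    rw [charFun_map_mul, charFun_gaussianReal, Real.coe_toNNReal _ (variance_nonneg _ _)]
    congr 1
    push_cast
    ring
  have hnn : 0 ≤ ∑ i, c₀ i ^ 2 * Var[Y i 0; P] :=
    Finset.sum_nonneg fun i _ => mul_nonneg (sq_nonneg _) (variance_nonneg _ _)
  rw [hid, charFun_gaussianReal, Real.coe_toNNReal _ hnn]
  simp only [hscale]
  rw [← Complex.exp_sum]
  congr 1
  push_cast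
  rw [Finset.sum_neg_distrib, ← Finset.sum_div, ← Finset.sum_mul]
  ring

end CentralLimit

/-! ### Second moments and convergence in measure -/

section Moments

variable {Ω : Type*} [MeasurableSpace Ω] {P : Measure Ω}

/-- Cauchy–Schwarz under the integral, without independence: the weights of one sample point are
dependent. This is the source of the factor `L`. -/
theorem variance_sum_le [IsProbabilityMeasure P] {κ : Type*} (s : Finset κ) {f : κ → Ω → ℝ}
    (hf : ∀ k ∈ s, MemLp (f k) 2 P) :
    Var[fun ω => ∑ k ∈ s, f k ω; P] ≤ s.card * ∑ k ∈ s, Var[f k; P] := by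
  have hi : ∀ k ∈ s, Integrable (f k) P := fun k hk => (hf k hk).integrable one_le_two
  have hsq : ∀ k ∈ s, Integrable (fun ω => (f k ω - P[f k]) ^ 2) P :=
    fun k hk => ((hf k hk).sub (memLp_const _)).integrable_sq
  have hsum : MemLp (fun ω => ∑ k ∈ s, f k ω) 2 P := memLp_finsetSum s hf
  have hvar : ∀ k ∈ s, Var[f k; P] = ∫ ω, (f k ω - P[f k]) ^ 2 ∂P :=
    fun k hk => variance_eq_integral (hf k hk).aemeasurable
  rw [variance_eq_integral hsum.aemeasurable, Finset.sum_congr rfl hvar,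
    ← integral_finsetSum s hsq, ← integral_const_mul]
  refine integral_mono (hsum.sub (memLp_const _)).integrable_sq
    ((integrable_finsetSum s hsq).const_mul _) fun ω => ?_
  simp only
  rw [integral_finsetSum s hi, ← Finset.sum_sub_distrib]
  exact sq_sum_le_card_mul_sum_sq

theorem tendstoInMeasure_zero_of_tendsto_integral {f : ℕ → Ω → ℝ}
    (hf : ∀ m, Integrable (f m) P) (hnn : ∀ m ω, 0 ≤ f m ω)
    (hlim : Tendsto (fun m => ∫ ω, f m ω ∂P) atTop (𝓝 0)) :
    TendstoInMeasure P f atTop (0 : Ω → ℝ) := by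
  refine tendstoInMeasure_of_tendsto_eLpNorm one_ne_zero (fun m => (hf m).aestronglyMeasurable)
    aestronglyMeasurable_zero ?_
  have h : ∀ m, eLpNorm (f m - 0) 1 P = ENNReal.ofReal (∫ ω, f m ω ∂P) := by
    intro m
    rw [sub_zero, eLpNorm_one_eq_lintegral_enorm,
      ofReal_integral_eq_lintegral_ofReal (hf m) (Eventually.of_forall (hnn m))]
    exact lintegral_congr fun ω => Real.enorm_of_nonneg (hnn m ω)
  simp only [h]
  simpa using ENNReal.tendsto_ofReal hlim

/-- A bound valid only where `f` is small suffices, since the event where `f` exceeds `δ` has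
vanishing measure. It transfers the local expansion to the random matrices. -/
theorem tendstoInMeasure_zero_of_abs_le {f g : ℕ → Ω → ℝ}
    (hf : TendstoInMeasure P f atTop (0 : Ω → ℝ)) {δ C : ℝ} (hδ : 0 < δ) (hC : 0 < C)
    (hg : ∀ᶠ m in atTop, ∀ᵐ ω ∂P, f m ω ≤ δ → |g m ω| ≤ C * f m ω) :
    TendstoInMeasure P g atTop (0 : Ω → ℝ) := by
  rw [tendstoInMeasure_iff_norm] at hf ⊢
  intro ε hε
  have hlim := hf (min δ (ε / C)) (lt_min hδ (by positivity))
  refine tendsto_of_tendsto_of_tendsto_of_le_of_le' tendsto_const_nhds hlim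
    (Eventually.of_forall fun _ => zero_le) ?_
  filter_upwards [hg] with m hm
  refine measure_mono_ae ?_
  filter_upwards [hm] with ω hω h
  change ε ≤ ‖g m ω - (0 : Ω → ℝ) ω‖ at h
  change min δ (ε / C) ≤ ‖f m ω - (0 : Ω → ℝ) ω‖
  simp only [Pi.zero_apply, sub_zero, Real.norm_eq_abs] at h ⊢
  by_contra! hlt
  have h1 := (le_abs_self _).trans_lt hlt
  have h2 := hω (h1.le.trans (min_le_left _ _))
  have h3 : C * f m ω < ε := by
    have := h1.trans_le (min_le_right _ _)
    rwa [lt_div_iff₀' hC] at this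
  linarith

end Moments

/-! ### Mean square error of a sample average -/

section SampleMean

variable {Ω : Type*} [MeasurableSpace Ω] {P : Measure Ω} [IsProbabilityMeasure P]

theorem integral_sq_average_sub {Y : ℕ → Ω → ℝ} (hY : MemLp (Y 0) 2 P)
    (hind : iIndepFun Y P) (hident : ∀ n, IdentDistrib (Y n) (Y 0) P P) {n : ℕ} (hn : 0 < n) :
    ∫ ω, (1 / (n : ℝ) * ∑ k ∈ Finset.range n, Y k ω - P[Y 0]) ^ 2 ∂P = Var[Y 0; P] / n := by
  have hn' : (n : ℝ) ≠ 0 := Nat.cast_ne_zero.2 hn.ne'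
  have hYk : ∀ k, MemLp (Y k) 2 P := fun k => (hident k).memLp_iff.2 hY
  have hS : MemLp (fun ω => ∑ k ∈ Finset.range n, Y k ω) 2 P := memLp_finsetSum _ fun k _ => hYk k
  have hmean : ∫ ω, 1 / (n : ℝ) * ∑ k ∈ Finset.range n, Y k ω ∂P = P[Y 0] := by
    rw [integral_const_mul, integral_finsetSum _ fun k _ => (hYk k).integrable one_le_two,
      Finset.sum_congr rfl fun k _ => (hident k).integral_eq, Finset.sum_const, Finset.card_range,
      nsmul_eq_mul]
    field_simp
  have hvar : Var[fun ω => ∑ k ∈ Finset.range n, Y k ω; P] = n * Var[Y 0; P] := by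
    have h := IndepFun.variance_sum (s := Finset.range n) (fun k _ => hYk k)
      fun k _ k' _ hkk => hind.indepFun hkk
    rw [Finset.sum_congr rfl fun k _ => (hident k).variance_eq, Finset.sum_const,
      Finset.card_range, nsmul_eq_mul] at h
    rw [← h]
    congr 1
    ext ω
    simp
  have h := variance_eq_integral (μ := P) (hS.const_mul (1 / (n : ℝ))).aemeasurable
  rw [hmean, variance_const_mul, hvar] at h
  rw [← h]
  field_simp

end SampleMean

/-! ### Stationarity of `u` and the variance of one row -/

section Model

variable {Θ Λ : Type*} [MeasurableSpace Θ] {L : ℕ}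
  {ν : Measure Θ} {ψ : Λ → Θ → ℝ} {p : Λ → ℝ} {grid : Fin L → Λ}

theorem measurable_weight (hψm : ∀ l, Measurable (ψ (grid l))) (j : Fin L) :
    Measurable (weight ψ p grid j) := by
  unfold weight
  fun_prop

theorem z_nonneg (hψ : ∀ l t, 0 ≤ ψ (grid l) t) (l : Fin L) : 0 ≤ z ν ψ (grid l) :=
  integral_nonneg (hψ l)

/-- With division by zero equal to zero, a vanishing `z` makes row `i` of `F` zero, so no power of
`F` has a positive entry at `(i, i)`. For `p` the same happens with column `i`. -/
theorem z_pos (hψ : ∀ l t, 0 ≤ ψ (grid l) t) (hF : (F ν ψ p grid).IsIrreducible) (i : Fin L) :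
    0 < z ν ψ (grid i) := by
  refine (z_nonneg hψ i).lt_of_ne' fun h0 => ?_
  obtain ⟨k, hk, hpow⟩ := (Matrix.isIrreducible_iff_exists_pow_pos hF.nonneg).1 hF i i
  obtain ⟨k, rfl⟩ := Nat.exists_eq_succ_of_ne_zero hk.ne'
  rw [pow_succ', Matrix.mul_apply] at hpow
  simp [F, localDensity, h0] at hpow

theorem p_pos (hp : ∀ l, 0 ≤ p (grid l)) (hF : (F ν ψ p grid).IsIrreducible) (i : Fin L) :
    0 < p (grid i) := by
  refine (hp i).lt_of_ne' fun h0 => ?_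
  obtain ⟨k, hk, hpow⟩ := (Matrix.isIrreducible_iff_exists_pow_pos hF.nonneg).1 hF i i
  obtain ⟨k, rfl⟩ := Nat.exists_eq_succ_of_ne_zero hk.ne'
  rw [pow_succ, Matrix.mul_apply] at hpow
  simp [F, weight, h0] at hpow

theorem measurable_ofReal_localDensity (hψm : ∀ l, Measurable (ψ (grid l))) (i : Fin L) :
    Measurable fun t => ENNReal.ofReal (localDensity ν ψ (grid i) t) :=
  ((hψm i).div_const _).ennreal_ofReal

theorem integral_weight_localLaw (hψm : ∀ l, Measurable (ψ (grid l)))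
    (hψ : ∀ l t, 0 ≤ ψ (grid l) t) (i j : Fin L) :
    ∫ t, weight ψ p grid j t ∂localLaw ν ψ (grid i) = F ν ψ p grid i j := by
  rw [localLaw, integral_withDensity_eq_integral_toReal_smul
    (measurable_ofReal_localDensity hψm i) (by simp)]
  simp only [F, Matrix.of_apply]
  refine integral_congr_ae (Eventually.of_forall fun t => ?_)
  simp only [smul_eq_mul]
  have hnn : 0 ≤ localDensity ν ψ (grid i) t := div_nonneg (hψ i t) (z_nonneg hψ i)
  rw [ENNReal.toReal_ofReal hnn, mul_comm]

/-- The sum can differ from 1 only where the common denominator vanishes, and there the density of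
row `i` vanishes too. -/
theorem sum_weight_ae (hψm : ∀ l, Measurable (ψ (grid l))) (hψ : ∀ l t, 0 ≤ ψ (grid l) t)
    (hp : ∀ l, 0 ≤ p (grid l)) (hF : (F ν ψ p grid).IsIrreducible) (i : Fin L) :
    ∀ᵐ t ∂localLaw ν ψ (grid i), ∑ j, weight ψ p grid j t = 1 := by
  rw [localLaw, ae_withDensity_iff (measurable_ofReal_localDensity hψm i)]
  refine Eventually.of_forall fun t ht => ?_
  have hpos : 0 < ψ (grid i) t := by
    refine (hψ i t).lt_of_ne' fun h0 => ht ?_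
    simp [localDensity, h0]
  have hsum : 0 < ∑ l, ψ (grid l) t * p (grid l) :=
    Finset.sum_pos' (fun l _ => mul_nonneg (hψ l t) (hp l))
      ⟨i, Finset.mem_univ i, mul_pos hpos (p_pos hp hF i)⟩
  simp only [weight]
  rw [← Finset.sum_div, div_self hsum.ne']

theorem u_pos (hψ : ∀ l t, 0 ≤ ψ (grid l) t) (hp : ∀ l, 0 ≤ p (grid l))
    (hF : (F ν ψ p grid).IsIrreducible) (l : Fin L) : 0 < u ν ψ p grid l := by
  have h : ∀ k, 0 < z ν ψ (grid k) * p (grid k) := fun k => mul_pos (z_pos hψ hF k) (p_pos hp hF k)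
  exact div_pos (mul_pos (Nat.cast_pos.2 l.pos) (h l))
    (Finset.sum_pos (fun k _ => h k) ⟨l, Finset.mem_univ l⟩)

theorem sum_u (hψ : ∀ l t, 0 ≤ ψ (grid l) t) (hp : ∀ l, 0 ≤ p (grid l))
    (hF : (F ν ψ p grid).IsIrreducible) : ∑ l, u ν ψ p grid l = L := by
  obtain rfl | hL := L.eq_zero_or_pos
  · simp
  have h : ∀ k, 0 < z ν ψ (grid k) * p (grid k) := fun k => mul_pos (z_pos hψ hF k) (p_pos hp hF k)
  simp only [u]
  rw [← Finset.sum_div, ← Finset.mul_sum,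
    mul_div_cancel_right₀ _ (Finset.sum_pos (fun k _ => h k) ⟨⟨0, hL⟩, Finset.mem_univ _⟩).ne']

/-- Multiplying `a_j` by its denominator gives the pointwise identity ∑_i ψ_i p_i a_j = ψ_j p_j,
which is then integrated. -/
theorem sum_u_mul_F (hψm : ∀ l, Measurable (ψ (grid l))) (hψ : ∀ l t, 0 ≤ ψ (grid l) t)
    (hψi : ∀ l, Integrable (ψ (grid l)) ν) (hp : ∀ l, 0 ≤ p (grid l))
    (hF : (F ν ψ p grid).IsIrreducible) (j : Fin L) :
    ∑ i, u ν ψ p grid i * F ν ψ p grid i j = u ν ψ p grid j := by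
  have hint : ∀ i, Integrable (fun t => weight ψ p grid j t * ψ (grid i) t) ν := by
    intro i
    refine (hψi i).bdd_mul (c := 1) (measurable_weight hψm j).aestronglyMeasurable
      (Eventually.of_forall fun t => ?_)
    rw [Real.norm_of_nonneg (weight_nonneg hψ hp j t)]
    exact weight_le_one hψ hp j t
  have hzF : ∀ i, z ν ψ (grid i) * F ν ψ p grid i j
      = ∫ t, weight ψ p grid j t * ψ (grid i) t ∂ν := by
    intro i
    simp only [F, Matrix.of_apply, localDensity, ← mul_div_assoc]
    rw [integral_div, mul_div_cancel₀ _ (z_pos hψ hF i).ne']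
  have key : ∑ i, z ν ψ (grid i) * p (grid i) * F ν ψ p grid i j = z ν ψ (grid j) * p (grid j) := by
    have h1 : ∀ i, z ν ψ (grid i) * p (grid i) * F ν ψ p grid i j
        = ∫ t, weight ψ p grid j t * ψ (grid i) t * p (grid i) ∂ν := by
      intro i
      rw [integral_mul_const, ← hzF]
      ring
    simp only [h1]
    rw [← integral_finsetSum _ fun i _ => (hint i).mul_const _, z, ← integral_mul_const]
    refine integral_congr_ae (Eventually.of_forall fun t => ?_)
    simp only [mul_assoc]
    rw [← Finset.mul_sum, weight]
    -- Where the denominator is zero, so is each nonnegative summand, and the convention for 0/0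
    -- does no harm.
    rcases eq_or_ne (∑ l, ψ (grid l) t * p (grid l)) 0 with h0 | h0
    · rw [h0, mul_zero]
      exact ((Finset.sum_eq_zero_iff_of_nonneg fun l _ => mul_nonneg (hψ l t) (hp l)).1 h0 j
        (Finset.mem_univ j)).symm
    · exact div_mul_cancel₀ _ h0
  simp only [u]
  rw [← key, Finset.mul_sum, Finset.sum_div]
  exact Finset.sum_congr rfl fun i _ => by ring

/-- If `B` is a generalized inverse of `1 - Fᵀ`, the asymptotic variance contributed by the samples
of row `i` is controlled by the escape probabilities `Q i j`. -/
theorem sq_mul_variance_le [∀ i, IsProbabilityMeasure (localLaw ν ψ (grid i))]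
    (hψm : ∀ l, Measurable (ψ (grid l))) (hψ : ∀ l t, 0 ≤ ψ (grid l) t)
    (hψi : ∀ l, Integrable (ψ (grid l)) ν) (hp : ∀ l, 0 ≤ p (grid l))
    (hF : (F ν ψ p grid).IsIrreducible) {B : Matrix (Fin L) (Fin L) ℝ}
    (hB : ∀ i j, ∑ l, (B l j - B l i) = 0 ∧
        ∀ k, (B k j - B k i) - ∑ m, (B m j - B m i) * F ν ψ p grid m k
          = (if k = j then 1 else 0) - (if k = i then 1 else 0)) (l i : Fin L) :
    u ν ψ p grid i ^ 2 * Var[fun t => ∑ j, B l j * weight ψ p grid j t; localLaw ν ψ (grid i)]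
      ≤ u ν ψ p grid l ^ 2 * (L * ∑ j ∈ Finset.univ.erase i, R ν ψ p grid i j /
          Q (F ν ψ p grid) (F_mem_rowStochastic hψm hψ hψi hp hF) i j ^ 2) := by
  set s : Finset (Fin L) := Finset.univ.erase i with hs
  set a := fun j => weight ψ p grid j with ha
  have hmem : ∀ j, MemLp (a j) 2 (localLaw ν ψ (grid i)) := fun j =>
    MemLp.of_bound (measurable_weight hψm j).aestronglyMeasurable 1
      (Eventually.of_forall fun t => by
        rw [Real.norm_of_nonneg (weight_nonneg hψ hp j t)]
        exact weight_le_one hψ hp j t)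
  have hmemB : ∀ j, MemLp (fun t => (B l j - B l i) * a j t) 2 (localLaw ν ψ (grid i)) :=
    fun j => (hmem j).const_mul _
  have hvar : Var[fun t => ∑ j, B l j * a j t; localLaw ν ψ (grid i)]
      = Var[fun t => ∑ j ∈ s, (B l j - B l i) * a j t; localLaw ν ψ (grid i)] := by
    -- As the weights sum to 1 almost surely, subtracting `B l i` from all coefficients changes the
    -- sum by a constant and removes the term `j = i`.
    rw [← variance_add_const (X := fun t => ∑ j ∈ s, (B l j - B l i) * a j t)
      (memLp_finsetSum s fun j _ => hmemB j).aestronglyMeasurable (B l i)]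
    refine variance_congr ?_
    filter_upwards [sum_weight_ae hψm hψ hp hF i] with t ht
    have h1 : ∑ j, (B l j - B l i) * a j t = ∑ j ∈ s, (B l j - B l i) * a j t := by
      rw [hs, ← Finset.add_sum_erase _ _ (Finset.mem_univ i), sub_self, zero_mul, zero_add]
    have h2 : ∑ j, a j t = 1 := ht
    rw [← h1]
    simp only [sub_mul, Finset.sum_sub_distrib]
    rw [← Finset.mul_sum, h2]
    ring
  have hcard : (s.card : ℝ) ≤ L := by
    have := Finset.card_le_univ s
    rw [Fintype.card_fin] at this
    exact_mod_cast this
  have hle := variance_sum_le (P := localLaw ν ψ (grid i)) s fun j _ => hmemB j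
  simp only [variance_const_mul] at hle
  have hnn : 0 ≤ ∑ j ∈ s, (B l j - B l i) ^ 2 * Var[a j; localLaw ν ψ (grid i)] :=
    Finset.sum_nonneg fun j _ => mul_nonneg (sq_nonneg _) (variance_nonneg _ _)
  rw [hvar]
  calc _ ≤ u ν ψ p grid i ^ 2 *
        (L * ∑ j ∈ s, (B l j - B l i) ^ 2 * Var[a j; localLaw ν ψ (grid i)]) := by
        refine mul_le_mul_of_nonneg_left (hle.trans ?_) (sq_nonneg _)
        exact mul_le_mul_of_nonneg_right hcard hnn
    _ = L * ∑ j ∈ s, (u ν ψ p grid i * (B l j - B l i)) ^ 2 * R ν ψ p grid i j := by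
        rw [mul_left_comm, Finset.mul_sum]
        congr 1
        exact Finset.sum_congr rfl fun j _ => by rw [R]; ring
    _ ≤ L * ∑ j ∈ s, u ν ψ p grid l ^ 2 * (R ν ψ p grid i j /
          Q (F ν ψ p grid) (F_mem_rowStochastic hψm hψ hψi hp hF) i j ^ 2) := by
        refine mul_le_mul_of_nonneg_left (Finset.sum_le_sum fun j hj => ?_) (Nat.cast_nonneg _)
        have hij : i ≠ j := (Finset.ne_of_mem_erase hj).symm
        obtain ⟨hQ, hle⟩ := Q_pos_and_abs_mul_le (F_mem_rowStochastic hψm hψ hψi hp hF) hF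
          (u_pos hψ hp hF) (sum_u_mul_F hψm hψ hψi hp hF) hij (hB i j).1 (hB i j).2 l
        rw [← mul_div_assoc, mul_div_right_comm]
        refine mul_le_mul_of_nonneg_right ?_ (variance_nonneg _ _)
        rw [le_div_iff₀ (pow_pos hQ 2), ← mul_pow, ← sq_abs]
        refine pow_le_pow_left₀ (abs_nonneg _) ?_ 2
        rwa [abs_mul, abs_mul, abs_of_pos hQ, abs_of_pos (u_pos hψ hp hF i)]
    _ = _ := by rw [← Finset.mul_sum, mul_left_comm]

end Model

/-! ### Limits of the sample size ratios -/

section SampleSize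

variable {T n : ℕ → ℕ} {w : ℝ}

theorem tendsto_atTop_of_tendsto_ratio (hT : Tendsto T atTop atTop)
    (hw : Tendsto (fun m => (n m : ℝ) / (T m : ℝ)) atTop (𝓝 w)) (hwpos : 0 < w) :
    Tendsto n atTop atTop := by
  have hT' : Tendsto (fun m => (T m : ℝ)) atTop atTop := tendsto_natCast_atTop_atTop.comp hT
  rw [← tendsto_natCast_atTop_iff (R := ℝ)]
  refine (hw.pos_mul_atTop hwpos hT').congr' ?_
  filter_upwards [hT'.eventually_gt_atTop 0] with m hm
  exact div_mul_cancel₀ _ hm.ne'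

theorem tendsto_sqrt_div_sqrt (hw : Tendsto (fun m => (n m : ℝ) / (T m : ℝ)) atTop (𝓝 w))
    (hwpos : 0 < w) : Tendsto (fun m => √(T m) / √(n m)) atTop (𝓝 (√w)⁻¹) := by
  refine (hw.sqrt.inv₀ (Real.sqrt_ne_zero'.2 hwpos)).congr fun m => ?_
  rw [Real.sqrt_div (Nat.cast_nonneg _), inv_div]

theorem tendsto_sqrt_div_zero (hT : Tendsto T atTop atTop)
    (hw : Tendsto (fun m => (n m : ℝ) / (T m : ℝ)) atTop (𝓝 w)) (hwpos : 0 < w) :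
    Tendsto (fun m => √(T m) / (n m : ℝ)) atTop (𝓝 0) := by
  have hT' : Tendsto (fun m => (T m : ℝ)) atTop atTop := tendsto_natCast_atTop_atTop.comp hT
  have h := (hw.inv₀ hwpos.ne').mul (tendsto_inv_atTop_zero.comp (Real.tendsto_sqrt_atTop.comp hT'))
  rw [mul_zero] at h
  refine h.congr' ?_
  filter_upwards [hT'.eventually_gt_atTop 0] with m hm
  have hs := Real.sqrt_pos.2 hm
  simp only [Function.comp_apply]
  rw [inv_div, div_mul_eq_mul_div]
  congr 1
  rw [mul_inv_eq_iff_eq_mul₀ hs.ne', Real.mul_self_sqrt hm.le]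

end SampleSize

/-! ### Fluctuations of the estimated matrix -/

section Estimator

variable {Θ Λ Ω : Type*} [MeasurableSpace Θ] [MeasurableSpace Ω]
  {ν : Measure Θ} {P : Measure Ω}
  {L : ℕ} {grid : Fin L → Λ} {ψ : Λ → Θ → ℝ} {p : Λ → ℝ}
  {X : Fin L → ℕ → Ω → Θ}

theorem identDistrib_comp (hX : ∀ l n, HasLaw (X l n) (localLaw ν ψ (grid l)) P)
    {f : Θ → ℝ} (hf : Measurable f) (i : Fin L) (n : ℕ) :
    IdentDistrib (fun ω => f (X i n ω)) (fun ω => f (X i 0 ω)) P P :=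
  IdentDistrib.comp ⟨(hX i n).aemeasurable, (hX i 0).aemeasurable,
    (hX i n).map_eq.trans (hX i 0).map_eq.symm⟩ hf

theorem integral_comp_sample (hX : ∀ l n, HasLaw (X l n) (localLaw ν ψ (grid l)) P)
    {f : Θ → ℝ} (hf : Measurable f) (i : Fin L) :
    ∫ ω, f (X i 0 ω) ∂P = ∫ t, f t ∂localLaw ν ψ (grid i) :=
  (hX i 0).integral_comp hf.aestronglyMeasurable

theorem variance_comp_sample (hX : ∀ l n, HasLaw (X l n) (localLaw ν ψ (grid l)) P)
    {f : Θ → ℝ} (hf : Measurable f) (i : Fin L) :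
    Var[fun ω => f (X i 0 ω); P] = Var[f; localLaw ν ψ (grid i)] := by
  rw [← (hX i 0).map_eq, variance_map hf.aemeasurable (hX i 0).aemeasurable]
  rfl

variable [IsProbabilityMeasure P]

theorem memLp_weight_sample (hψm : ∀ l, Measurable (ψ (grid l)))
    (hψ : ∀ l t, 0 ≤ ψ (grid l) t) (hp : ∀ l, 0 ≤ p (grid l))
    (hX : ∀ l n, HasLaw (X l n) (localLaw ν ψ (grid l)) P) (i j : Fin L) (n : ℕ) :
    MemLp (fun ω => weight ψ p grid j (X i n ω)) 2 P :=
  MemLp.of_bound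
    ((measurable_weight hψm j).comp_aemeasurable (hX i n).aemeasurable).aestronglyMeasurable 1
    (Eventually.of_forall fun ω => by
      rw [Real.norm_of_nonneg (weight_nonneg hψ hp j _)]
      exact weight_le_one hψ hp j _)

theorem memLp_Fhat (hψm : ∀ l, Measurable (ψ (grid l)))
    (hψ : ∀ l t, 0 ≤ ψ (grid l) t) (hp : ∀ l, 0 ≤ p (grid l))
    (hX : ∀ l n, HasLaw (X l n) (localLaw ν ψ (grid l)) P) (N : Fin L → ℕ) (i j : Fin L) :
    MemLp (fun ω => Fhat ψ p grid N (fun l n => X l n ω) i j) 2 P :=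
  (memLp_finsetSum _ fun n _ => memLp_weight_sample hψm hψ hp hX i j n).const_mul _

theorem integral_sq_Fhat_sub (hψm : ∀ l, Measurable (ψ (grid l)))
    (hψ : ∀ l t, 0 ≤ ψ (grid l) t) (hp : ∀ l, 0 ≤ p (grid l))
    (hX : ∀ l n, HasLaw (X l n) (localLaw ν ψ (grid l)) P)
    (hXind : iIndepFun (fun k : Fin L × ℕ => X k.1 k.2) P) {N : Fin L → ℕ} (i j : Fin L)
    (hN : 0 < N i) :
    ∫ ω, (Fhat ψ p grid N (fun l n => X l n ω) i j - F ν ψ p grid i j) ^ 2 ∂P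
      = R ν ψ p grid i j / N i := by
  have hm := measurable_weight (p := p) hψm j
  have hind : iIndepFun (fun n ω => weight ψ p grid j (X i n ω)) P :=
    (hXind.precomp (g := fun n => (i, n)) fun a b hab => (Prod.mk.inj hab).2).comp
      (fun _ => weight ψ p grid j) fun _ => hm
  have h := integral_sq_average_sub (memLp_weight_sample hψm hψ hp hX i j 0) hind
    (identDistrib_comp hX hm i) hN
  rw [variance_comp_sample hX hm, integral_comp_sample hX hm,
    integral_weight_localLaw hψm hψ] at h
  exact h

/-- The expectation is √N ∑ R_ij / N_i, of order N^(-1/2), so convergence already holds in L¹. This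
disposes of the quadratic remainder. -/
theorem tendstoInMeasure_sqrt_mul_sum_sq (hψm : ∀ l, Measurable (ψ (grid l)))
    (hψ : ∀ l t, 0 ≤ ψ (grid l) t) (hp : ∀ l, 0 ≤ p (grid l))
    (hX : ∀ l n, HasLaw (X l n) (localLaw ν ψ (grid l)) P)
    (hXind : iIndepFun (fun k : Fin L × ℕ => X k.1 k.2) P)
    {N : ℕ → Fin L → ℕ} {w : Fin L → ℝ}
    (hN : Tendsto (fun m => ∑ l, N m l) atTop atTop)
    (hw : ∀ l, Tendsto (fun m => (N m l : ℝ) / ((∑ k, N m k : ℕ) : ℝ)) atTop (𝓝 (w l)))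
    (hwpos : ∀ l, 0 < w l) :
    TendstoInMeasure P (fun m ω => √((∑ k, N m k : ℕ) : ℝ) * ∑ i, ∑ j,
        (Fhat ψ p grid (N m) (fun l n => X l n ω) i j - F ν ψ p grid i j) ^ 2)
      atTop (0 : Ω → ℝ) := by
  have hint : ∀ m i j, Integrable
      (fun ω => (Fhat ψ p grid (N m) (fun l n => X l n ω) i j - F ν ψ p grid i j) ^ 2) P :=
    fun m i j => ((memLp_Fhat hψm hψ hp hX (N m) i j).sub (memLp_const _)).integrable_sq
  refine tendstoInMeasure_zero_of_tendsto_integral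
    (fun m => (integrable_finsetSum _ fun i _ => integrable_finsetSum _ fun j _ =>
      hint m i j).const_mul _)
    (fun m ω => mul_nonneg (Real.sqrt_nonneg _) (Finset.sum_nonneg fun i _ =>
      Finset.sum_nonneg fun j _ => sq_nonneg _)) ?_
  have hlim : Tendsto (fun m => ∑ i, ∑ j,
      √((∑ k, N m k : ℕ) : ℝ) / (N m i : ℝ) * R ν ψ p grid i j) atTop (𝓝 0) := by
    have := tendsto_finsetSum Finset.univ fun i _ => tendsto_finsetSum Finset.univ fun j _ =>
      (tendsto_sqrt_div_zero hN (hw i) (hwpos i)).mul_const (R ν ψ p grid i j)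
    simpa using this
  refine hlim.congr' ?_
  have hNpos : ∀ᶠ m in atTop, ∀ i, 0 < N m i := eventually_all.2 fun i =>
    (tendsto_atTop_of_tendsto_ratio hN (hw i) (hwpos i)).eventually_gt_atTop 0
  filter_upwards [hNpos] with m hm
  rw [integral_const_mul, integral_finsetSum _ fun i _ => integrable_finsetSum _ fun j _ =>
    hint m i j, Finset.mul_sum]
  refine Finset.sum_congr rfl fun i _ => ?_
  rw [integral_finsetSum _ fun j _ => hint m i j, Finset.mul_sum]
  refine Finset.sum_congr rfl fun j _ => ?_
  rw [integral_sq_Fhat_sub hψm hψ hp hX hXind i j (hm i)]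
  ring

/-- Central limit theorem for the linearization of the estimator. -/
theorem tendstoInDistribution_linear (hψm : ∀ l, Measurable (ψ (grid l)))
    (hψ : ∀ l t, 0 ≤ ψ (grid l) t) (hp : ∀ l, 0 ≤ p (grid l))
    (hX : ∀ l n, HasLaw (X l n) (localLaw ν ψ (grid l)) P)
    (hXind : iIndepFun (fun k : Fin L × ℕ => X k.1 k.2) P)
    {N : ℕ → Fin L → ℕ} {w : Fin L → ℝ}
    (hN : Tendsto (fun m => ∑ l, N m l) atTop atTop)
    (hw : ∀ l, Tendsto (fun m => (N m l : ℝ) / ((∑ k, N m k : ℕ) : ℝ)) atTop (𝓝 (w l)))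
    (hwpos : ∀ l, 0 < w l) (b v : Fin L → ℝ) :
    TendstoInDistribution
      (fun m ω => ∑ i, v i * (√((∑ k, N m k : ℕ) : ℝ) / √(N m i)) *
        ((√(N m i))⁻¹ * (∑ n ∈ Finset.range (N m i), ∑ j, b j * weight ψ p grid j (X i n ω)
          - N m i * ∑ j, b j * F ν ψ p grid i j)))
      atTop (id : ℝ → ℝ) (fun _ => P)
      (gaussianReal 0 (∑ i, (v i * (√(w i))⁻¹) ^ 2 *
        Var[fun t => ∑ j, b j * weight ψ p grid j t; localLaw ν ψ (grid i)]).toNNReal) := by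
  have hm : Measurable fun t => ∑ j, b j * weight ψ p grid j t :=
    Finset.measurable_fun_sum _ fun j _ => (measurable_weight hψm j).const_mul _
  have hmean : ∀ i, ∫ ω, ∑ j, b j * weight ψ p grid j (X i 0 ω) ∂P
      = ∑ j, b j * F ν ψ p grid i j := by
    intro i
    rw [integral_finsetSum _ fun j _ =>
      ((memLp_weight_sample hψm hψ hp hX i j 0).integrable one_le_two).const_mul _]
    refine Finset.sum_congr rfl fun j _ => ?_
    rw [integral_const_mul, integral_comp_sample hX (measurable_weight hψm j),
      integral_weight_localLaw hψm hψ]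
  have h := tendstoInDistribution_sum_mul_inv_sqrt_mul_sum (P := P)
    (Y := fun i n ω => ∑ j, b j * weight ψ p grid j (X i n ω))
    (fun i => memLp_finsetSum _ fun j _ => (memLp_weight_sample hψm hψ hp hX i j 0).const_mul _)
    (hXind.comp (fun _ t => ∑ j, b j * weight ψ p grid j t) fun _ => hm)
    (identDistrib_comp hX hm)
    (N := N) (fun i => tendsto_atTop_of_tendsto_ratio hN (hw i) (hwpos i))
    (c := fun m i => v i * (√((∑ k, N m k : ℕ) : ℝ) / √(N m i)))
    (c₀ := fun i => v i * (√(w i))⁻¹)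
    (fun i => (tendsto_sqrt_div_sqrt (hw i) (hwpos i)).const_mul (v i))
  simp only [hmean, variance_comp_sample hX hm] at h
  exact h

/-- Matches the row-wise normalization of the central limit theorem with the linear term of the
perturbation expansion; `T` will be the square root of the total sample size. -/
theorem sum_mul_inv_sqrt_mul_eq {N : Fin L → ℕ} (hN : ∀ i, 0 < N i) (T : ℝ) (b v : Fin L → ℝ)
    (x : Fin L → ℕ → Θ) :
    ∑ i, v i * (T / √(N i)) *
        ((√(N i))⁻¹ * (∑ n ∈ Finset.range (N i), ∑ j, b j * weight ψ p grid j (x i n)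
          - N i * ∑ j, b j * F ν ψ p grid i j))
      = T * ∑ j, b j * ∑ i, v i * (Fhat ψ p grid N x i j - F ν ψ p grid i j) := by
  have h1 : ∀ i, v i * (T / √(N i)) *
        ((√(N i))⁻¹ * (∑ n ∈ Finset.range (N i), ∑ j, b j * weight ψ p grid j (x i n)
          - N i * ∑ j, b j * F ν ψ p grid i j))
      = ∑ j, T * (b j * (v i * (Fhat ψ p grid N x i j - F ν ψ p grid i j))) := by
    intro i
    have hpos : (0 : ℝ) < N i := Nat.cast_pos.2 (hN i)
    have hs : √(N i : ℝ) * √(N i : ℝ) = N i := Real.mul_self_sqrt hpos.le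
    have h2 : ∀ j, T * (b j * (v i * (Fhat ψ p grid N x i j - F ν ψ p grid i j)))
        = v i * T * (1 / (N i : ℝ)) * (b j * ∑ n ∈ Finset.range (N i), weight ψ p grid j (x i n)
          - N i * (b j * F ν ψ p grid i j)) := by
      intro j
      simp only [Fhat, Matrix.of_apply]
      field_simp
    simp only [h2]
    rw [← Finset.mul_sum, Finset.sum_sub_distrib, ← Finset.mul_sum, Finset.sum_comm]
    simp only [← Finset.mul_sum]
    rw [← mul_assoc]
    congr 1
    have h3 : 1 / (N i : ℝ) = (√(N i : ℝ))⁻¹ * (√(N i : ℝ))⁻¹ := by rw [← mul_inv, hs, one_div]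
    rw [h3]
    ring
  simp only [h1]
  rw [Finset.sum_comm]
  simp only [← Finset.mul_sum]

end Estimator

end EMUS

end

/-! ### The limit theorem and the bound on the asymptotic variance -/

theorem mainTheorem6
    {Θ Λ Ω : Type*} [MeasurableSpace Θ] [MeasurableSpace Ω]
    (ν : Measure Θ) (P : Measure Ω) [IsProbabilityMeasure P]
    {L : ℕ} (grid : Fin L → Λ) (ψ : Λ → Θ → ℝ) (p : Λ → ℝ)
    (hψm : ∀ l, Measurable (ψ (grid l)))
    (hψ : ∀ l t, 0 ≤ ψ (grid l) t)
    (hψi : ∀ l, Integrable (ψ (grid l)) ν)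
    (hp : ∀ l, 0 ≤ p (grid l))
    -- irreducibility of `F`
    (hF : (EMUS.F ν ψ p grid).IsIrreducible)
    -- the samples `X ℓ n` have law `π_{λ_ℓ}` and are independent across `ℓ` and `n`
    (X : Fin L → ℕ → Ω → Θ)
    (hX : ∀ l n, HasLaw (X l n) (EMUS.localLaw ν ψ (grid l)) P)
    (hXind : iIndepFun (fun k : Fin L × ℕ => X k.1 k.2) P)
    -- the sample sizes `N m ℓ`, with total tending to infinity and limiting fractions `w ℓ > 0`
    (N : ℕ → Fin L → ℕ) (w : Fin L → ℝ)
    (hN : Tendsto (fun m => ∑ l, N m l) atTop atTop)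
    (hw : ∀ l, Tendsto (fun m => (N m l : ℝ) / ((∑ k, N m k : ℕ) : ℝ)) atTop (𝓝 (w l)))
    (hwpos : ∀ l, 0 < w l)
    -- the estimators
    (uhat : ℕ → Ω → Fin L → ℝ)
    (huhatm : ∀ m, AEMeasurable (uhat m) P)
    (huhat : ∀ᶠ m in atTop, ∀ᵐ ω ∂P,
      EMUS.IsEMUSEstimate (EMUS.Fhat ψ p grid (N m) fun l n => X l n ω) (uhat m ω)) :
    ∃ σsq : Fin L → ℝ≥0,
      (∀ l, TendstoInDistribution
        (fun m ω => √((∑ k, N m k : ℕ) : ℝ) * (uhat m ω l - EMUS.u ν ψ p grid l))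
        atTop (id : ℝ → ℝ) (fun _ => P) (gaussianReal 0 (σsq l))) ∧
      (⨆ l, (σsq l : ℝ) / EMUS.u ν ψ p grid l ^ 2) ≤
        L * ∑ i, (w i)⁻¹ * ∑ j ∈ Finset.univ.erase i,
          EMUS.R ν ψ p grid i j /
            EMUS.Q (EMUS.F ν ψ p grid)
              (EMUS.F_mem_rowStochastic hψm hψ hψi hp hF) i j ^ 2 := by

  have hprob : ∀ i, IsProbabilityMeasure (EMUS.localLaw ν ψ (grid i)) := fun i =>
    (hX i 0).isProbabilityMeasure_iff.1 inferInstance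
  have hFs := EMUS.F_mem_rowStochastic hψm hψ hψi hp hF
  have hu := EMUS.u_pos hψ hp hF
  have huF := EMUS.sum_u_mul_F hψm hψ hψi hp hF
  obtain ⟨B, hB1, hB2⟩ := EMUS.exists_fundamental_matrix hF
    (fun k => Matrix.sum_row_of_mem_rowStochastic hFs k) hu huF
  refine ⟨fun l => (∑ i, (EMUS.u ν ψ p grid i * (√(w i))⁻¹) ^ 2 *
    Var[fun t => ∑ j, B l j * EMUS.weight ψ p grid j t;
      EMUS.localLaw ν ψ (grid i)]).toNNReal, fun l => ?_, ?_⟩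
  · refine tendstoInDistribution_of_tendstoInMeasure_sub _ _
      (EMUS.tendstoInDistribution_linear hψm hψ hp hX hXind hN hw hwpos (B l)
        (EMUS.u ν ψ p grid)) ?_
      fun m => ((aemeasurable_pi_iff.1 (huhatm m) l).sub_const _).const_mul _
    obtain ⟨δ, hδ, C, hC, hbound⟩ := EMUS.exists_abs_sub_le_mul_sum_sq _ B hB1 huF
    refine EMUS.tendstoInMeasure_zero_of_abs_le
      (EMUS.tendstoInMeasure_sqrt_mul_sum_sq hψm hψ hp hX hXind hN hw hwpos) hδ hC ?_
    have hNpos : ∀ᶠ m in atTop, ∀ i, 0 < N m i := eventually_all.2 fun i =>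
      (EMUS.tendsto_atTop_of_tendsto_ratio hN (hw i) (hwpos i)).eventually_gt_atTop 0
    filter_upwards [huhat, hNpos, hN.eventually_ge_atTop 1] with m hm hmN hm1
    filter_upwards [hm] with ω hω hle
    have hT : 1 ≤ √((∑ k, N m k : ℕ) : ℝ) := Real.one_le_sqrt.2 (by exact_mod_cast hm1)
    set T := √((∑ k, N m k : ℕ) : ℝ)
    set q := ∑ i, ∑ j, (EMUS.Fhat ψ p grid (N m) (fun l n => X l n ω) i j
      - EMUS.F ν ψ p grid i j) ^ 2
    have hq : 0 ≤ q := Finset.sum_nonneg fun i _ => Finset.sum_nonneg fun j _ => sq_nonneg _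
    have hfix : ∀ k, ∑ i, uhat m ω i * EMUS.Fhat ψ p grid (N m) (fun l n => X l n ω) i k
        = uhat m ω k := by
      intro k
      conv_rhs => rw [hω.1]
      simp only [Matrix.mulVec, dotProduct, Matrix.transpose_apply, mul_comm]
    -- Smallness is known for `T * q`; as `1 ≤ T`, it passes to `q`.
    have h := hbound _ _ hfix (hω.2.trans (EMUS.sum_u hψ hp hF).symm)
      ((le_mul_of_one_le_left hq hT).trans hle) l
    simp only [Pi.sub_apply]
    rw [EMUS.sum_mul_inv_sqrt_mul_eq hmN, ← mul_sub, abs_mul, abs_of_nonneg (by positivity),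
      mul_left_comm]
    exact mul_le_mul_of_nonneg_left h (by positivity)
  · have hS : ∀ i, 0 ≤ ∑ j ∈ Finset.univ.erase i, EMUS.R ν ψ p grid i j /
        EMUS.Q (EMUS.F ν ψ p grid) hFs i j ^ 2 := fun i =>
      Finset.sum_nonneg fun j _ => div_nonneg (variance_nonneg _ _) (sq_nonneg _)
    -- For `L = 0` the supremum is over an empty type and equals 0, hence the nonnegativity of the
    -- right-hand side.
    refine Real.iSup_le (fun l => ?_) (mul_nonneg (Nat.cast_nonneg _) (Finset.sum_nonneg
      fun i _ => mul_nonneg (inv_nonneg.2 (hwpos i).le) (hS i)))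
    rw [Real.coe_toNNReal _ (Finset.sum_nonneg fun i _ =>
      mul_nonneg (sq_nonneg _) (variance_nonneg _ _)), div_le_iff₀ (pow_pos (hu l) 2),
      Finset.mul_sum, Finset.sum_mul]
    refine Finset.sum_le_sum fun i _ => ?_
    have h := mul_le_mul_of_nonneg_left
      (EMUS.sq_mul_variance_le hψm hψ hψi hp hF hB2 l i) (inv_nonneg.2 (hwpos i).le)
    rw [mul_pow, inv_pow, Real.sq_sqrt (hwpos i).le]
    linarith
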